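/- Let $h_1,h_2:\mathbb{R}\to\mathbb{R}$ be cost functions. A pair $u=(u_1,u_2)$ of functions $u_i:\mathbb{R}\to\mathbb{R}$ is called an \emph{admissible solution} of the Hamilton--Jacobi system $$u_1(x)=h_1(x)-u_1'u_2'-\tfrac12(u_1')^2,\qquad u_2(x)=h_2(x)-u_1'u_2'-\tfrac12(u_2')^2 \qquad (\mathrm{HJ})$$ if (A1) $u$ is absolutely continuous on every compact interval and (HJ) holds at almost every $x\in\mathbb{R}$; (A2) there is a constant $K$ with $|u(x)|\le K(1+|x|)$ for all $x\in\mathbb{R}$; (A3) at every $y\in\mathbb{R}$ the derivative $u'$ has one-sided limits $u'(y+)$ and $u'(y-)$, and wherever $u'(y+)\ne u'(y-)$, at least one of $u_1'(y+)+u_2'(y+)\le 0$ and $u_1'(y-)+u_2'(y-)\ge 0$ holds. \textbf{Theorem.} For every $C>1$ there is $\delta>0$, depending only on $C$, such that the following holds. Let $-\infty=x_0<x_1<\dots<x_N<x_{N+1}=+\infty$ ($N\ge 0$) be a finite subdivision, let $\mathcal{I}_j=\,]x_j,x_{j+1}[$ for $j=0,\dots,N$, and let $h_1,h_2:\mathbb{R}\to\mathbb{R}$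 be continuous functions that are smooth ($C^\infty$) on each $\mathcal{I}_j$. Assume that (1) $\frac1C\le h_i'(x)\le C$ for $i=1,2$ and all $x\in\mathcal{I}_0\cup\dots\cup\mathcal{I}_N$; (2) $\sup_{\xi,\eta\in\mathcal{I}_0}|h_i'(\xi)-h_i'(\eta)|\le\delta$ for $i=1,2$. Then (HJ) has exactly one admissible solution. -/

import Mathlib

open Set Filter Topology MeasureTheory
open scoped ContDiff

namespace CooperativeGame

/-- A finite subdivision `-∞ = x₀ < x₁ < ⋯ < x_N < x_{N+1} = +∞` of the extended real line. -/
def IsSubdivision {N : ℕ} (x : Fin (N + 2) → EReal) : Prop :=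
  StrictMono x ∧ x 0 = ⊥ ∧ x (Fin.last (N + 1)) = ⊤

/-- The open interval `I_j = ]x_j, x_{j+1}[` of the real line, for `j = 0, …, N`. -/
def interval {N : ℕ} (x : Fin (N + 2) → EReal) (j : Fin (N + 1)) : Set ℝ :=
  {t : ℝ | x j.castSucc < (t : EReal) ∧ (t : EReal) < x j.succ}

/-- `f` is continuous on the line and smooth on each open interval of the subdivision. No condition
is put on the derivatives at the division points. -/
def IsPiecewiseSmooth {N : ℕ} (x : Fin (N + 2) → EReal) (f : ℝ → ℝ) : Prop :=
  Continuous f ∧ ∀ j : Fin (N + 1), ContDiffOn ℝ ∞ f (interval x j)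

/-- The stationary Hamilton-Jacobi system at the point `t`, for the values `v` of the unknowns
and `p` of their derivatives (the two players are indexed by `0` and `1`). -/
def SatisfiesHJ (h : Fin 2 → ℝ → ℝ) (t : ℝ) (v p : Fin 2 → ℝ) : Prop :=
  v 0 = h 0 t - p 0 * p 1 - (p 0) ^ 2 / 2 ∧
  v 1 = h 1 t - p 0 * p 1 - (p 1) ^ 2 / 2

/-- The derivative of `f`, considered where `f` is differentiable, tends to `l` at `y` from the
right: `f'(y+) = l`. -/
def HasRightDerivLimit (f : ℝ → ℝ) (y l : ℝ) : Prop :=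
  Tendsto (deriv f) (𝓝[{t : ℝ | y < t ∧ DifferentiableAt ℝ f t}] y) (𝓝 l)

/-- The derivative of `f`, considered where `f` is differentiable, tends to `l` at `y` from the
left: `f'(y-) = l`. -/
def HasLeftDerivLimit (f : ℝ → ℝ) (y l : ℝ) : Prop :=
  Tendsto (deriv f) (𝓝[{t : ℝ | t < y ∧ DifferentiableAt ℝ f t}] y) (𝓝 l)

/-- Admissible solutions of the Hamilton-Jacobi system with costs `h`. -/
structure IsAdmissible (h u : Fin 2 → ℝ → ℝ) : Prop where
  /-- The components are absolutely continuous on every compact interval. -/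
  absolutelyContinuous : ∀ (i : Fin 2) (a b : ℝ), AbsolutelyContinuousOnInterval (u i) a b
  /-- The system holds at almost every point. -/
  equation : ∀ᵐ t : ℝ, (∀ i : Fin 2, DifferentiableAt ℝ (u i) t) ∧
    SatisfiesHJ h t (fun i => u i t) (fun i => deriv (u i) t)
  /-- Growth at infinity is at most linear. -/
  growth : ∃ K : ℝ, ∀ (i : Fin 2) (t : ℝ), |u i t| ≤ K * (1 + |t|)
  /-- The derivative has one-sided limits everywhere, and where it jumps (that is, where the two
  limits differ) they satisfy the jump condition. -/
  jumps : ∀ y : ℝ, ∃ pr pl : Fin 2 → ℝ,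
    (∀ i, HasRightDerivLimit (u i) y (pr i)) ∧ (∀ i, HasLeftDerivLimit (u i) y (pl i)) ∧
    (pr ≠ pl → pr 0 + pr 1 ≤ 0 ∨ 0 ≤ pl 0 + pl 1)

end CooperativeGame

/-! Put U = u₀ + u₁, W = u₀ - u₁, H = h₀ + h₁, J = h₀ - h₁, s = U', d = W', a = H - U, b = J - W.
The system becomes 4a = 3s² - d², 2b = sd, which determines (s, d) up to a common sign. By
`monotone_identity`, the pairing of the differences of (a, b) and (s, d) for two states is (s +
s')/4 times a positive definite form. So on the branch s > 0 two solutions for the same costs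
approach each other as x increases and separate as x decreases.

Existence: on the branch s > 0 a region ε ≤ a ≤ M, |b| ≤ a is invariant as x increases, by the
bounds on the slopes (`clamped_invariant`). Solutions started at -n converge as n → ∞ by contraction
(`clamped_contraction`), and their limit is a C¹ solution on the line.

Uniqueness: by the jump condition, as x increases s can jump only from positive to negative. If s <
0 and a ≥ 0 somewhere, both persist to the right and a grows superlinearly; hence s < 0 forces a < 0
(`sub_neg_of_sr_neg`). Now let x decrease inside the unbounded interval on the left, where the
slopes of H, J are nearly constants σ, β, with equilibrium s = σ, d = β. A solution visiting s < 0
is driven away from it (`dist_grows`), returns to s ≥ 0 for good and escapes superlinearly, against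
the growth bound (`s_nonneg_of_nonneg`). So s ≥ 0 near -∞, and a solution differing there from the
constructed one would escape as well (`eq_of_s_nonneg`). Contraction carries the agreement to the
right (`eq_forward`). -/

namespace CooperativeGame

/-! ### Real induction and one-sided differential inequalities. -/

/-- Induction along a half-line of the reals. -/
lemma real_induction {P : ℝ → Prop} {α : ℝ} (h0 : P α)
    (hright : ∀ y, α ≤ y → P y → ∀ᶠ z in 𝓝[>] y, P z)
    (hleft : ∀ y, α < y → (∀ z ∈ Ico α y, P z) → P y) : ∀ y, α ≤ y → P y := by
  by_contra! hcon
  obtain ⟨β, hβ, hPβ⟩ := hcon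
  set S : Set ℝ := {y | α ≤ y ∧ ¬ P y} with hS
  have hbd : BddBelow S := ⟨α, fun y hy => hy.1⟩
  have hne : S.Nonempty := ⟨β, hβ, hPβ⟩
  set m := sInf S with hm
  have hαm : α ≤ m := le_csInf hne fun y hy => hy.1
  have hbelow : ∀ z ∈ Ico α m, P z := by
    intro z hz
    by_contra hPz
    exact absurd (csInf_le hbd (show z ∈ S from ⟨hz.1, hPz⟩)) (not_le.2 hz.2)
  have hPm : P m := by
    rcases hαm.eq_or_lt with h | h
    · rw [← h]; exact h0
    · exact hleft m h hbelow
  obtain ⟨u, hu, hu'⟩ := mem_nhdsGT_iff_exists_Ioo_subset.1 (hright m hαm hPm)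
  obtain ⟨z, hz, hzu⟩ := exists_lt_of_csInf_lt hne (show sInf S < u from hu)
  have hmz : m ≤ z := csInf_le hbd hz
  rcases hmz.eq_or_lt with h | h
  · exact hz.2 (h ▸ hPm)
  · exact hz.2 (hu' ⟨h, hzu⟩)

lemma add_mul_le_of_right_deriv_ge {f f' : ℝ → ℝ} {α β c : ℝ} (hαβ : α ≤ β)
    (hf : ContinuousOn f (Icc α β))
    (hf' : ∀ t ∈ Ico α β, HasDerivWithinAt f (f' t) (Ici t) t)
    (hc : ∀ t ∈ Ico α β, c ≤ f' t) : f α + c * (β - α) ≤ f β := by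
  have := image_le_of_deriv_right_le_deriv_boundary (f := fun t => f α + c * (t - α))
    (f' := fun _ => c) (B := f) (B' := f') (a := α) (b := β) (by fun_prop)
    (fun t _ => by
      have : HasDerivAt (fun t => f α + c * (t - α)) (c * 1) t :=
        (((hasDerivAt_id t).sub_const α).const_mul c).const_add _
      simpa using this.hasDerivWithinAt)
    (by simp) hf hf' hc
  exact this (right_mem_Icc.2 hαβ)

/-- The right derivative of the positive part. -/
lemma exists_hasDerivWithinAt_posPart {f : ℝ → ℝ} {f' t : ℝ}
    (hf : HasDerivWithinAt f f' (Ici t) t) :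
    ∃ g, HasDerivWithinAt (fun z => max (f z) 0) g (Ici t) t ∧
      ((g = f' ∧ 0 ≤ f t) ∨ (g = 0 ∧ f t ≤ 0)) := by
  have hcont := hf.continuousWithinAt
  rcases lt_trichotomy (f t) 0 with h | h | h
  · refine ⟨0, ?_, Or.inr ⟨rfl, h.le⟩⟩
    refine (hasDerivWithinAt_const t (Ici t) (0 : ℝ)).congr_of_eventuallyEq ?_ (max_eq_right h.le)
    filter_upwards [hcont.eventually_lt_const h] with z hz using max_eq_right hz.le
  · refine ⟨max f' 0, ?_, ?_⟩
    · rw [hasDerivWithinAt_iff_tendsto_slope, Ici_sdiff_left] at hf ⊢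
      refine (hf.max tendsto_const_nhds).congr' ?_
      filter_upwards [self_mem_nhdsWithin] with z (hz : t < z)
      simp only [slope, h, vsub_eq_sub, smul_eq_mul, sub_zero, max_self]
      rw [mul_max_of_nonneg _ _ (inv_nonneg.2 (sub_nonneg.2 hz.le)), mul_zero]
    · rcases le_total f' 0 with h' | h'
      · exact Or.inr ⟨max_eq_right h', h.le⟩
      · exact Or.inl ⟨max_eq_left h', h.ge⟩
  · refine ⟨f', ?_, Or.inl ⟨rfl, h.le⟩⟩
    refine hf.congr_of_eventuallyEq ?_ (max_eq_left h.le)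
    filter_upwards [hcont.eventually_const_lt h] with z hz using max_eq_left hz.le

/-- The right derivative of the absolute value. -/
lemma exists_hasDerivWithinAt_abs {f : ℝ → ℝ} {f' t : ℝ}
    (hf : HasDerivWithinAt f f' (Ici t) t) :
    ∃ g, HasDerivWithinAt (fun z => |f z|) g (Ici t) t ∧
      (0 ≤ f t → f' ≤ g) ∧ (f t ≤ 0 → -f' ≤ g) ∧ (0 < f t → g = f') ∧ (f t < 0 → g = -f') := by
  have hcont := hf.continuousWithinAt
  rcases lt_trichotomy (f t) 0 with h | h | h
  · refine ⟨-f', ?_, fun h' => absurd h (not_lt.2 h'), fun _ => le_rfl,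
      fun h' => absurd h h'.not_gt, fun _ => rfl⟩
    refine hf.neg.congr_of_eventuallyEq ?_ (abs_of_neg h)
    filter_upwards [hcont.eventually_lt_const h] with z hz using abs_of_neg hz
  · refine ⟨|f'|, ?_, fun _ => le_abs_self _, fun _ => neg_le_abs _,
      fun h' => absurd h h'.ne', fun h' => absurd h h'.ne⟩
    rw [hasDerivWithinAt_iff_tendsto_slope, Ici_sdiff_left] at hf ⊢
    refine hf.abs.congr' ?_
    filter_upwards [self_mem_nhdsWithin] with z (hz : t < z)
    simp only [slope, h, vsub_eq_sub, smul_eq_mul, sub_zero, abs_zero, abs_mul]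
    rw [abs_of_nonneg (inv_nonneg.2 (sub_nonneg.2 hz.le))]
  · refine ⟨f', ?_, fun _ => le_rfl, fun h' => absurd h (not_lt.2 h'), fun _ => rfl,
      fun h' => absurd h h'.not_gt⟩
    refine hf.congr_of_eventuallyEq ?_ (abs_of_pos h)
    filter_upwards [hcont.eventually_const_lt h] with z hz using abs_of_pos hz

lemma false_of_superlinear {f : ℝ → ℝ} {Y : ℝ}
    (hf : ∃ K, ∀ y, Y ≤ y → f y ≤ K * (1 + |y|))
    (hgrow : ∀ M : ℝ, ∃ T, Y ≤ T ∧ ∀ y, T ≤ y → f T + M * (y - T) ≤ f y) : False := by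
  obtain ⟨K, hK⟩ := hf
  obtain ⟨T, hYT, hT⟩ := hgrow (|K| + 1)
  -- The excess of `f T + (|K| + 1) * (y - T)` over `|K| * (1 + y)` is at least `y - |f T| - (|K| +
  -- 1) * |T| - |K|`, which is `|T| + 1` for this `y`.
  set y := |T| + (|f T| + (|K| + 1) * |T| + |K|+ 1) with hy
  have hA : 0 ≤ |f T| + (|K| + 1) * |T| + |K| + 1 := by positivity
  have hTy : T ≤ y := by have := le_abs_self T; linarith
  have h0 : 0 ≤ y := by positivity
  have h1 := hT y hTy
  have h2 := hK y (hYT.trans hTy)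
  rw [abs_of_nonneg h0] at h2
  have h3 : K * (1 + y) ≤ |K| * (1 + y) :=
    mul_le_mul_of_nonneg_right (le_abs_self K) (by linarith)
  have h4 := neg_abs_le (f T)
  have h5 : (|K| + 1) * T ≤ (|K| + 1) * |T| :=
    mul_le_mul_of_nonneg_left (le_abs_self T) (by positivity)
  have h6 := abs_nonneg T
  nlinarith

lemma eventually_add_mul_le_of_right_deriv_ge {f f' : ℝ → ℝ} {Y y c : ℝ} (hf : Continuous f)
    (hf' : ∀ t, Y ≤ t → HasDerivWithinAt f (f' t) (Ici t) t) (hy : Y ≤ y)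
    (hc : ∀ᶠ t in 𝓝[≥] y, c ≤ f' t) : ∀ᶠ z in 𝓝[>] y, f y + c * (z - y) ≤ f z := by
  obtain ⟨u, hu, hu'⟩ := mem_nhdsGE_iff_exists_Ico_subset.1 hc
  filter_upwards [Ioo_mem_nhdsGT hu] with z hz
  exact add_mul_le_of_right_deriv_ge hz.1.le hf.continuousOn (fun t ht => hf' t (hy.trans ht.1))
    fun t ht => hu' ⟨ht.1, ht.2.trans hz.2⟩

/-! ### Algebra of the quadratic map from derivatives to values. -/

/-- The distance of the values in terms of the distance of the derivatives. -/
lemma value_dist_le {a b s d a' b' s' d' M θ : ℝ} (ha : 4 * a = 3 * s ^ 2 - d ^ 2)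
    (hb : 2 * b = s * d) (ha' : 4 * a' = 3 * s' ^ 2 - d' ^ 2) (hb' : 2 * b' = s' * d')
    (hs' : |s'| ≤ M) (hd' : |d'| ≤ M) (hθ : 0 < θ) :
    |a - a'| + |b - b'| ≤ (1 + 5 / (4 * θ)) * ((s - s') ^ 2 + (d - d') ^ 2) + θ * M ^ 2 := by
  set e := s - s' with he
  set g := d - d' with hg
  have hs : s = s' + e := by ring
  have hd : d = d' + g := by ring
  have h1 : 4 * (a - a') = 3 * e ^ 2 - g ^ 2 + (6 * s' * e - 2 * d' * g) := by
    rw [mul_sub, ha, ha', hs, hd]; ring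
  have h2 : 2 * (b - b') = e * g + (s' * g + d' * e) := by
    rw [mul_sub, hb, hb', hs, hd]; ring
  have hM : 0 ≤ M := (abs_nonneg _).trans hs'
  have b1 : |4 * (a - a')| ≤ 3 * |e| ^ 2 + |g| ^ 2 + (6 * M * |e| + 2 * M * |g|) := by
    rw [h1]
    refine (abs_add_le _ _).trans (add_le_add ?_ ?_)
    · refine (abs_sub _ _).trans ?_
      simp [abs_mul]
    · refine (abs_sub _ _).trans ?_
      simp only [abs_mul, Nat.abs_ofNat]
      gcongr
  have b2 : |2 * (b - b')| ≤ |e| * |g| + (M * |g| + M * |e|) := by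
    rw [h2]
    refine (abs_add_le _ _).trans (add_le_add (abs_mul _ _).le ?_)
    refine (abs_add_le _ _).trans ?_
    simp only [abs_mul]
    gcongr
  rw [abs_mul, abs_of_pos (by norm_num : (0 : ℝ) < 4)] at b1
  rw [abs_mul, abs_of_pos (by norm_num : (0 : ℝ) < 2)] at b2
  have h3 : |a - a'| + |b - b'| ≤ (|e| ^ 2 + |g| ^ 2) + M * (2 * |e| + |g|) := by
    nlinarith [sq_nonneg (|e| - |g|), abs_nonneg e, abs_nonneg g]
  -- Young's inequality with parameter `θ`: a small constant error buys a bound by squares.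
  have h4 : M * (2 * |e| + |g|) ≤ 5 / (4 * θ) * (|e| ^ 2 + |g| ^ 2) + θ * M ^ 2 := by
    have h5 : (2 * |e| + |g|) ^ 2 ≤ 5 * (|e| ^ 2 + |g| ^ 2) := by
      nlinarith [sq_nonneg (|e| - 2 * |g|)]
    have h6 : 5 / (4 * θ) * (|e| ^ 2 + |g| ^ 2) + θ * M ^ 2 - M * (2 * |e| + |g|)
        = ((2 * θ * M - (2 * |e| + |g|)) ^ 2 + (5 * (|e| ^ 2 + |g| ^ 2) - (2 * |e| + |g|) ^ 2))
          / (4 * θ) := by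
      field_simp; ring
    have h7 : 0 ≤ ((2 * θ * M - (2 * |e| + |g|)) ^ 2
        + (5 * (|e| ^ 2 + |g| ^ 2) - (2 * |e| + |g|) ^ 2)) / (4 * θ) :=
      div_nonneg (add_nonneg (sq_nonneg _) (by linarith)) (by linarith)
    linarith
  rw [sq_abs, sq_abs] at *
  linarith

/-- The monotonicity identity behind all the estimates. -/
lemma monotone_identity {a b s d a' b' s' d' : ℝ} (ha : 4 * a = 3 * s ^ 2 - d ^ 2)
    (hb : 2 * b = s * d) (ha' : 4 * a' = 3 * s' ^ 2 - d' ^ 2) (hb' : 2 * b' = s' * d') :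
    (a - a') * (s - s') + (b - b') * (d - d')
      = (s + s') * (3 * (s - s') ^ 2 + (d - d') ^ 2) / 4 := by
  linear_combination (s - s') / 4 * ha - (s - s') / 4 * ha' + (d - d') / 2 * hb
    - (d - d') / 2 * hb'

/-! ### Trajectories in reversed time. -/

/-- A solution read in reversed time: `a` and `b` are the sum and the difference of the components
of `h - u`, and `s`, `d` those of the derivatives of `u`. -/
structure BackwardTrajectory (Y : ℝ) (a b s d ka kb : ℝ → ℝ) : Prop where
  continuous_a : Continuous a
  continuous_b : Continuous b
  deriv_a : ∀ y, Y ≤ y → HasDerivWithinAt a (s y - ka y) (Ici y) y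
  deriv_b : ∀ y, Y ≤ y → HasDerivWithinAt b (d y - kb y) (Ici y) y
  eq_a : ∀ y, 4 * a y = 3 * s y ^ 2 - d y ^ 2
  eq_b : ∀ y, 2 * b y = s y * d y
  right_s : ∀ y, ContinuousWithinAt s (Ici y) y
  right_d : ∀ y, ContinuousWithinAt d (Ici y) y
  -- In reversed time `s` can jump only from negative to positive, so negative values are approached
  -- continuously from the left.
  left_s : ∀ y, s y < 0 → ContinuousWithinAt s (Iic y) y
  neg : ∀ y, s y < 0 → a y < 0
  growth : ∃ K, ∀ y, |a y| + |b y| ≤ K * (1 + |y|)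

namespace BackwardTrajectory

variable {Y : ℝ} {a b s d ka kb : ℝ → ℝ}

lemma mono (H : BackwardTrajectory Y a b s d ka kb) {Y' : ℝ} (h : Y ≤ Y') :
    BackwardTrajectory Y' a b s d ka kb :=
  { H with
    deriv_a := fun y hy => H.deriv_a y (h.trans hy)
    deriv_b := fun y hy => H.deriv_b y (h.trans hy) }

/-- This is the exchange of the two players; it reduces `s_nonneg` to the case `0 ≤ β`. -/
lemma flip (H : BackwardTrajectory Y a b s d ka kb) :
    BackwardTrajectory Y a (fun y => -b y) s (fun y => -d y) ka (fun y => -kb y) :=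
  { H with
    continuous_b := H.continuous_b.neg
    deriv_b := fun y hy => by
      convert! (H.deriv_b y hy).neg using 1
      ring
    eq_a := fun y => by rw [H.eq_a]; ring
    eq_b := fun y => by linear_combination -H.eq_b y
    right_d := fun y => (H.right_d y).neg
    growth := by simpa using H.growth }

lemma abs_add_abs_le_sq (H : BackwardTrajectory Y a b s d ka kb) (y : ℝ) :
    |a y| + |b y| ≤ (|s y| + |d y|) ^ 2 := by
  have h1 : |4 * a y| ≤ 3 * |s y| ^ 2 + |d y| ^ 2 := by
    rw [H.eq_a]
    refine (abs_sub _ _).trans ?_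
    simp [abs_mul]
  have h2 : |2 * b y| = |s y| * |d y| := by rw [H.eq_b, abs_mul]
  rw [abs_mul, abs_of_pos (by norm_num : (0 : ℝ) < 4)] at h1
  rw [abs_mul, abs_of_pos (by norm_num : (0 : ℝ) < 2)] at h2
  nlinarith [abs_nonneg (s y), abs_nonneg (d y)]

/-- The branch `s ≥ 0` cannot escape to infinity backwards, within linear growth. -/
lemma false_of_escape (H : BackwardTrajectory Y a b s d ka kb) {B : ℝ}
    (hka : ∀ y, Y ≤ y → |ka y| ≤ B) (hkb : ∀ y, Y ≤ y → |kb y| ≤ B)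
    (hs : ∀ y, Y ≤ y → 0 ≤ s y)
    (hinf : ∀ R, ∃ T, ∀ y, T ≤ y → R ≤ |a y| + |b y|) : False := by
  have hB : 0 ≤ B := (abs_nonneg _).trans (hka Y le_rfl)
  refine false_of_superlinear (f := fun y => a y + |b y|) (Y := Y) ?_ ?_
  · obtain ⟨K, hK⟩ := H.growth
    exact ⟨K, fun y _ => (add_le_add_left (le_abs_self _) _).trans (hK y)⟩
  · intro M
    -- For `s ≥ 0`, `b` has the sign of `d`, so `a + |b|` grows at rate at least `|s| + |d| - 2 *
    -- B`; beyond this threshold the rate is at least `|M|`.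
    obtain ⟨T, hT⟩ := hinf ((|M| + 2 * B) ^ 2)
    refine ⟨max T Y, le_max_right _ _, fun y hy => ?_⟩
    choose! g hg hg1 hg2 _ _ using fun t (ht : Y ≤ t) =>
      exists_hasDerivWithinAt_abs (H.deriv_b t ht)
    refine add_mul_le_of_right_deriv_ge (f' := fun t => (s t - ka t) + g t) hy
      (H.continuous_a.add H.continuous_b.abs).continuousOn
      (fun t ht => ?_) (fun t ht => ?_)
    · have htY : Y ≤ t := (le_max_right _ _).trans ht.1
      exact (H.deriv_a t htY).add (hg t htY)
    · have htY : Y ≤ t := (le_max_right _ _).trans ht.1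
      have h1 := (hT t ((le_max_left _ _).trans ht.1)).trans (H.abs_add_abs_le_sq t)
      have h2 : |M| + 2 * B ≤ |s t| + |d t| :=
        le_of_sq_le_sq h1 (by positivity)
      have hst := hs t htY
      rw [abs_of_nonneg hst] at h2
      have h3 := le_of_abs_le (hka t htY)
      have h4 := le_of_abs_le (hkb t htY)
      have h4' := neg_le_of_abs_le (hkb t htY)
      have h5 : |d t| - B ≤ g t := by
        have hbt := H.eq_b t
        rcases lt_trichotomy (b t) 0 with hb | hb | hb
        · have : d t ≤ 0 := by
            by_contra! hd
            nlinarith [mul_nonneg hst hd.le]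
          rw [abs_of_nonpos this]
          have := hg2 t htY hb.le
          linarith
        · rcases le_total 0 (d t) with hd | hd
          · rw [abs_of_nonneg hd]
            have := hg1 t htY hb.ge
            linarith
          · rw [abs_of_nonpos hd]
            have := hg2 t htY hb.le
            linarith
        · have : 0 ≤ d t := by
            by_contra! hd
            nlinarith [mul_nonneg hst (neg_nonneg.2 hd.le)]
          rw [abs_of_nonneg this]
          have := hg1 t htY hb.le
          linarith
      have h6 := le_abs_self M
      linarith

end BackwardTrajectory

/-! ### Repulsion from the equilibrium. -/

namespace BackwardTrajectory

/-- Rate of growth of the squared distance from an equilibrium. -/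
lemma equilibrium_dist_rate {a b s d ka kb σ β η : ℝ} (hσ : 0 < σ) (hβ : |β| ≤ σ)
    (ha : 4 * a = 3 * s ^ 2 - d ^ 2) (hb : 2 * b = s * d)
    (hka : |ka - σ| ≤ η) (hkb : |kb - β| ≤ η) (hη : η ≤ σ / 1000) (hs : -(σ / 2) ≤ s)
    (hfar : σ ^ 4 / 8 ≤ (a - (3 * σ ^ 2 - β ^ 2) / 4) ^ 2 + (b - σ * β / 2) ^ 2) :
    σ ^ 3 / 3000 ≤ (a - (3 * σ ^ 2 - β ^ 2) / 4) * (s - ka) + (b - σ * β / 2) * (d - kb) := by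
  set a' := (3 * σ ^ 2 - β ^ 2) / 4 with ha'
  set b' := σ * β / 2 with hb'
  have e1 : 4 * a' = 3 * σ ^ 2 - β ^ 2 := by rw [ha']; ring
  have e2 : 2 * b' = σ * β := by rw [hb']; ring
  have hid := monotone_identity ha hb e1 e2
  have hX := value_dist_le (M := σ) (θ := 1 / 12) ha hb e1 e2 (abs_of_pos hσ).le hβ (by norm_num)
  set q := (s - σ) ^ 2 + (d - β) ^ 2 with hq
  set X := |a - a'| + |b - b'| with hXdef
  have hX0 : 0 ≤ X := by positivity
  have hX1 : σ ^ 2 / 3 ≤ X := by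
    have h1 : (a - a') ^ 2 + (b - b') ^ 2 ≤ X ^ 2 := by
      rw [hXdef, ← sq_abs (a - a'), ← sq_abs (b - b')]
      nlinarith [mul_nonneg (abs_nonneg (a - a')) (abs_nonneg (b - b'))]
    refine le_of_sq_le_sq ?_ hX0
    nlinarith [pow_pos hσ 4]
  -- For `θ = 1 / 12` the factor `1 + 5 / (4 * θ)` is 16, and the error `σ ^ 2 / 12` is at most `X /
  -- 4`.
  have hqX : 3 / 64 * X ≤ q := by norm_num at hX; linarith
  have hpert : -(η * X) ≤ -((a - a') * (ka - σ)) - (b - b') * (kb - β) := by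
    have h1 : (a - a') * (ka - σ) ≤ |a - a'| * η :=
      (le_abs_self _).trans (by rw [abs_mul]; gcongr)
    have h2 : (b - b') * (kb - β) ≤ |b - b'| * η :=
      (le_abs_self _).trans (by rw [abs_mul]; gcongr)
    rw [hXdef]; linarith
  have hgain : σ / 8 * q ≤ (s + σ) * (3 * (s - σ) ^ 2 + (d - β) ^ 2) / 4 := by
    have h1 : q ≤ 3 * (s - σ) ^ 2 + (d - β) ^ 2 := by rw [hq]; linarith [sq_nonneg (s - σ)]
    have h2 : 0 ≤ q := by positivity
    have h3 : σ / 2 * q ≤ (s + σ) * (3 * (s - σ) ^ 2 + (d - β) ^ 2) :=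
      mul_le_mul (by linarith) h1 h2 (by linarith)
    linarith
  have h1 : η * X ≤ σ / 1000 * X := mul_le_mul_of_nonneg_right hη hX0
  have h2 : σ / 8 * (3 / 64 * X) ≤ σ / 8 * q := mul_le_mul_of_nonneg_left hqX (by positivity)
  have h3 : σ * (σ ^ 2 / 3) ≤ σ * X := mul_le_mul_of_nonneg_left hX1 hσ.le
  nlinarith

variable {Y : ℝ} {a b s d ka kb : ℝ → ℝ}

/-- The squared distance from `(a', b')`, where the second coordinate is only taken into account
between `0` and `b'`. -/
def clippedDist (a' b' u v : ℝ) : ℝ := (u - a') ^ 2 + max (b' - max v 0) 0 ^ 2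

lemma clippedDist_le {a' b' u v : ℝ} (hb' : 0 ≤ b') :
    clippedDist a' b' u v ≤ (u - a') ^ 2 + (v - b') ^ 2 := by
  unfold clippedDist
  rcases le_total v 0 with h | h
  · rw [max_eq_right h, sub_zero, max_eq_left hb']; nlinarith
  · rw [max_eq_left h]
    rcases le_total (b' - v) 0 with h' | h'
    · rw [max_eq_right h']; nlinarith [sq_nonneg (v - b')]
    · rw [max_eq_left h']; nlinarith

lemma clippedDist_zero_right {a' b' u : ℝ} (hb' : 0 ≤ b') :
    clippedDist a' b' u 0 = (u - a') ^ 2 + b' ^ 2 := by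
  simp [clippedDist, hb']

lemma deriv_clippedDist (H : BackwardTrajectory Y a b s d ka kb) (a' b' : ℝ) {y : ℝ}
    (hy : Y ≤ y) :
    ∃ g, HasDerivWithinAt (fun t => clippedDist a' b' (a t) (b t)) g (Ici y) y ∧
      (g = 2 * ((a y - a') * (s y - ka y)) ∨
        (0 ≤ b y ∧ b y ≤ b' ∧
          g = 2 * ((a y - a') * (s y - ka y) + (b y - b') * (d y - kb y)))) := by
  obtain ⟨g1, hg1, h1⟩ := exists_hasDerivWithinAt_posPart (H.deriv_b y hy)
  obtain ⟨g2, hg2, h2⟩ := exists_hasDerivWithinAt_posPart (hg1.const_sub b')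
  refine ⟨_, (((H.deriv_a y hy).sub_const a').pow 2).add (hg2.pow 2), ?_⟩
  rcases h2 with ⟨h2, h2'⟩ | ⟨h2, -⟩
  · rcases h1 with ⟨h1, h1'⟩ | ⟨h1, -⟩
    · refine Or.inr ⟨h1', ?_, ?_⟩
      · rw [max_eq_left h1'] at h2'; linarith
      · rw [h2, h1, max_eq_left h2', max_eq_left h1']; norm_num; ring
    · left; rw [h2, h1]; norm_num; ring
  · left; rw [h2]; norm_num; ring

lemma continuous_clippedDist (H : BackwardTrajectory Y a b s d ka kb) (a' b' : ℝ) :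
    Continuous fun t => clippedDist a' b' (a t) (b t) := by
  have h1 := H.continuous_a
  have h2 := H.continuous_b
  unfold clippedDist
  fun_prop

lemma deriv_equilibriumDist (H : BackwardTrajectory Y a b s d ka kb) (a' b' : ℝ) {y : ℝ}
    (hy : Y ≤ y) :
    HasDerivWithinAt (fun t => (a t - a') ^ 2 + (b t - b') ^ 2)
      (2 * ((a y - a') * (s y - ka y) + (b y - b') * (d y - kb y))) (Ici y) y := by
  convert! (((H.deriv_a y hy).sub_const a').pow 2).add (((H.deriv_b y hy).sub_const b').pow 2)
    using 1
  norm_num; ring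

/-- A trajectory that enters `s < 0` moves away from the equilibrium at a definite rate. -/
lemma dist_grows (H : BackwardTrajectory Y a b s d ka kb) {σ β η : ℝ} (hσ : 0 < σ) (hβ : 0 ≤ β)
    (hβσ : β ≤ σ) (hη : η ≤ σ / 1000) (hka : ∀ y, Y ≤ y → |ka y - σ| ≤ η)
    (hkb : ∀ y, Y ≤ y → |kb y - β| ≤ η) {y₁ : ℝ} (hy₁ : Y ≤ y₁) (hneg : s y₁ < 0) :
    ∀ y, y₁ ≤ y →
      σ ^ 4 / 4 + σ ^ 3 / 1500 * (y - y₁)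
          ≤ (a y - (3 * σ ^ 2 - β ^ 2) / 4) ^ 2 + (b y - σ * β / 2) ^ 2 ∧
      (s y ≤ 0 → σ ^ 4 / 4 + σ ^ 3 / 1500 * (y - y₁)
          ≤ clippedDist ((3 * σ ^ 2 - β ^ 2) / 4) (σ * β / 2) (a y) (b y)) := by
  set a' := (3 * σ ^ 2 - β ^ 2) / 4 with ha'
  set b' := σ * β / 2 with hb'
  have ha'1 : σ ^ 2 / 2 ≤ a' := by rw [ha']; nlinarith
  have hb'0 : 0 ≤ b' := by positivity
  have hb'1 : b' ≤ σ ^ 2 / 2 := by rw [hb']; nlinarith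
  have hσ2 : 0 < σ ^ 2 := by positivity
  have hσ3 : 0 < σ ^ 3 := by positivity
  have hσ4 : 0 < σ ^ 4 := by positivity
  have hβ' : |β| ≤ σ := by rwa [abs_of_nonneg hβ]
  set fE : ℝ → ℝ := fun t => (a t - a') ^ 2 + (b t - b') ^ 2 with hfE
  -- Where `s < 0` the true distance `fE` may shrink: `b < 0` gives `d > 0` and `b > b'` gives `d <
  -- 0`, so `b` may approach `b'`. Clipping discards these two ranges. The two distances fit
  -- together because `fN ≤ fE`, with equality at `s = 0`, where `b = 0`.
  set fN : ℝ → ℝ := fun t => clippedDist a' b' (a t) (b t) with hfN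
  have hNE : ∀ t, fN t ≤ fE t := fun t => clippedDist_le hb'0
  have hcE : Continuous fE := by
    have h1 := H.continuous_a
    have h2 := H.continuous_b
    fun_prop
  have hcN : Continuous fN := H.continuous_clippedDist a' b'
  choose! gN hgN hgN' using fun t (ht : Y ≤ t) => H.deriv_clippedDist a' b' ht
  have hNE0 : ∀ t, b t = 0 → fN t = fE t := by
    intro t ht
    simp only [hfN, hfE, ht, clippedDist_zero_right hb'0]; ring
  have hrate : ∀ t, Y ≤ t → -(σ / 2) ≤ s t → σ ^ 4 / 8 ≤ fE t →
      σ ^ 3 / 1500 ≤ 2 * ((a t - a') * (s t - ka t) + (b t - b') * (d t - kb t)) := by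
    intro t ht hst hft
    have := equilibrium_dist_rate hσ hβ' (H.eq_a t) (H.eq_b t) (hka t ht) (hkb t ht) hη hst hft
    rw [← ha', ← hb'] at this
    linarith
  -- For `s < 0` and `0 ≤ b ≤ b'` one has `d ≤ 0`, so `b` moves towards `b'` at rate at most `η`;
  -- the motion of `a < 0` away from `a'` outweighs this.
  have hNrate1 : ∀ t, Y ≤ t → s t < 0 → σ ^ 3 / 1500 ≤ gN t := by
    intro t ht hst
    have hat := H.neg t hst
    have hk1 := abs_le.1 (hka t ht)
    have hk2 := abs_le.1 (hkb t ht)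
    have h1 : σ ^ 2 / 2 * (999 / 1000 * σ) ≤ (a' - a t) * (ka t - s t) :=
      mul_le_mul (by linarith) (by linarith) (by positivity) (by linarith)
    rcases hgN' t ht with h | ⟨h0, h2, h⟩
    · rw [h]; nlinarith
    · rw [h]
      have hd : d t ≤ 0 := by
        by_contra! hd
        nlinarith [H.eq_b t, mul_pos (neg_pos.2 hst) hd]
      have h3 : (b' - b t) * (d t - kb t) ≤ σ ^ 2 / 2 * (σ / 1000) := by
        refine (mul_le_mul_of_nonneg_left (show d t - kb t ≤ σ / 1000 by linarith)
          (by linarith)).trans ?_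
        exact mul_le_mul_of_nonneg_right (by linarith) (by positivity)
      nlinarith
  -- Just after a zero of `s` either sign may occur, so the clipped rate is needed for all small
  -- `|s|`.
  have hNrate2 : ∀ t, Y ≤ t → |s t| < σ / 2 → a t < σ ^ 2 / 8 → σ ^ 4 / 8 ≤ fE t →
      σ ^ 3 / 1500 ≤ gN t := by
    intro t ht hst hat hft
    have hst' := abs_lt.1 hst
    have hk1 := abs_le.1 (hka t ht)
    rcases hgN' t ht with h | ⟨h0, h2, h⟩
    · rw [h]
      have h1 : σ ^ 2 / 4 * (499 / 1000 * σ) ≤ (a' - a t) * (ka t - s t) :=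
        mul_le_mul (by linarith) (by linarith) (by positivity) (by linarith)
      nlinarith
    · rw [h]; exact hrate t ht hst'.1.le hft
  have hgrow : ∀ y, Y ≤ y → 0 ≤ y - y₁ → σ ^ 4 / 4 + σ ^ 3 / 1500 * (y - y₁) ≤ fE y →
      σ ^ 4 / 8 < fE y := by
    intro y _ hy hE
    have : 0 ≤ σ ^ 3 / 1500 * (y - y₁) := by positivity
    linarith
  refine real_induction (P := fun y => σ ^ 4 / 4 + σ ^ 3 / 1500 * (y - y₁) ≤ fE y ∧
      (s y ≤ 0 → σ ^ 4 / 4 + σ ^ 3 / 1500 * (y - y₁) ≤ fN y)) ?_ ?_ ?_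
  · have : σ ^ 4 / 4 ≤ fN y₁ := by
      have h1 := H.neg y₁ hneg
      simp only [hfN, clippedDist]
      nlinarith [sq_nonneg (max (b' - max (b y₁) 0) 0)]
    simp only [sub_self, mul_zero, add_zero]
    exact ⟨this.trans (hNE _), fun _ => this⟩
  · rintro y hy ⟨hPE, hPN⟩
    have hYy : Y ≤ y := hy₁.trans hy
    have hEy := hgrow y hYy (sub_nonneg.2 hy) hPE
    have hEev : ∀ᶠ t in 𝓝[≥] y, σ ^ 4 / 8 < fE t :=
      (hcE.continuousWithinAt).eventually_const_lt hEy
    have hYev : ∀ᶠ t in 𝓝[≥] y, Y ≤ t := by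
      filter_upwards [self_mem_nhdsWithin] with t ht using hYy.trans ht
    rcases lt_or_ge 0 (s y) with hs | hs
    · have hsev : ∀ᶠ t in 𝓝[≥] y, 0 < s t := (H.right_s y).eventually_const_lt hs
      have := eventually_add_mul_le_of_right_deriv_ge (c := σ ^ 3 / 1500) hcE
        (fun t ht => H.deriv_equilibriumDist a' b' ht) hYy (by
          filter_upwards [hEev, hYev, hsev] with t h1 h2 h3
          exact hrate t h2 (by linarith) h1.le)
      filter_upwards [this, nhdsWithin_mono y Ioi_subset_Ici_self hsev] with z hz hsz
      exact ⟨by linarith, fun h => absurd hsz (not_lt.2 h)⟩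
    · have hNev : ∀ᶠ t in 𝓝[≥] y, σ ^ 3 / 1500 ≤ gN t := by
        rcases hs.lt_or_eq with hs | hs
        · filter_upwards [hYev, (H.right_s y).eventually_lt_const hs] with t h1 h2
          exact hNrate1 t h1 h2
        · have hay : a y < σ ^ 2 / 8 := by
            have := H.eq_a y
            rw [hs] at this
            nlinarith [sq_nonneg (d y)]
          have hsy : |s y| < σ / 2 := by rw [hs, abs_zero]; positivity
          filter_upwards [hYev, hEev, (H.right_s y).abs.eventually_lt_const hsy,
            H.continuous_a.continuousWithinAt.eventually_lt_const hay] with t h1 h2 h3 h4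
          exact hNrate2 t h1 h3 h4 h2.le
      filter_upwards [eventually_add_mul_le_of_right_deriv_ge hcN hgN hYy hNev] with z hz
      have := hPN hs
      have h2 : σ ^ 4 / 4 + σ ^ 3 / 1500 * (z - y₁) ≤ fN z := by linarith
      exact ⟨h2.trans (hNE z), fun _ => h2⟩
  · intro y hy hP
    have hcL : Continuous fun t => σ ^ 4 / 4 + σ ^ 3 / 1500 * (t - y₁) := by fun_prop
    have hev : ∀ᶠ z in 𝓝[<] y, z ∈ Ico y₁ y := by
      filter_upwards [Ioo_mem_nhdsLT hy] with z hz using ⟨hz.1.le, hz.2⟩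
    have hEy : σ ^ 4 / 4 + σ ^ 3 / 1500 * (y - y₁) ≤ fE y :=
      le_of_tendsto_of_tendsto (hcL.continuousWithinAt (s := Iio y))
        (hcE.continuousWithinAt (s := Iio y)) (hev.mono fun z hz => (hP z hz).1)
    refine ⟨hEy, fun hs => ?_⟩
    -- If `s y < 0`, then `s < 0` just before `y` too and the clipped bound passes to the limit; if
    -- `s y = 0`, the unclipped bound suffices.
    rcases hs.lt_or_eq with hs | hs
    · have hsev : ∀ᶠ z in 𝓝[<] y, s z < 0 :=
        ((H.left_s y hs).mono Iio_subset_Iic_self).eventually_lt_const hs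
      exact le_of_tendsto_of_tendsto (hcL.continuousWithinAt (s := Iio y))
        (hcN.continuousWithinAt (s := Iio y))
        (hev.mp (hsev.mono fun z hz hz' => (hP z hz').2 hz.le))
    · rw [hNE0 y (by have := H.eq_b y; rw [hs] at this; linarith)]
      exact hEy

end BackwardTrajectory

/-! ### Exclusion of the negative branch, and coincidence near -∞. -/

namespace BackwardTrajectory

variable {Y : ℝ} {a b s d ka kb : ℝ → ℝ}

/-- If `|d|` is large wherever `s ≤ 0`, then `s` becomes nonnegative. -/
lemma exists_s_nonneg (H : BackwardTrajectory Y a b s d ka kb) {B : ℝ}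
    (hkb : ∀ y, Y ≤ y → |kb y| ≤ B) (hd : ∀ y, Y ≤ y → s y ≤ 0 → B + 1 ≤ |d y|) :
    ∃ y, Y ≤ y ∧ 0 ≤ s y := by
  by_contra! hs
  choose! g hg _ _ hg3 hg4 using fun t (ht : Y ≤ t) =>
    exists_hasDerivWithinAt_abs (H.deriv_b t ht)
  have hB : 0 ≤ B := (abs_nonneg _).trans (hkb Y le_rfl)
  -- While `s < 0`, `b` and `d` have opposite signs and `|d| ≥ B + 1`, so `|b|` falls at rate at
  -- least 1 and would be negative at time `Y + |b Y| + 1`.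
  have h := add_mul_le_of_right_deriv_ge (f := fun t => -|b t|) (f' := fun t => -g t)
    (α := Y) (β := Y + |b Y| + 1) (c := 1) (by linarith [abs_nonneg (b Y)])
    H.continuous_b.abs.neg.continuousOn (fun t ht => (hg t ht.1).neg) (fun t ht => ?_)
  · have := abs_nonneg (b (Y + |b Y| + 1))
    linarith
  · have hst := hs t ht.1
    have hdt := hd t ht.1 hst.le
    have hk := _root_.abs_le.1 (hkb t ht.1)
    have hbt := H.eq_b t
    rcases le_or_gt 0 (d t) with h | h
    · rw [abs_of_nonneg h] at hdt
      have : b t < 0 := by nlinarith [mul_pos (neg_pos.2 hst) (show 0 < d t by linarith)]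
      rw [hg4 t ht.1 this]; linarith
    · rw [abs_of_neg h] at hdt
      have : 0 < b t := by nlinarith [mul_pos (neg_pos.2 hst) (neg_pos.2 h)]
      rw [hg3 t ht.1 this]; linarith

/-- If `|d|` is large wherever `s ≤ 0`, then `s ≥ 0` persists. -/
lemma s_nonneg_persists (H : BackwardTrajectory Y a b s d ka kb) {B : ℝ}
    (hkb : ∀ y, Y ≤ y → |kb y| ≤ B) (hd : ∀ y, Y ≤ y → s y ≤ 0 → B + 1 ≤ |d y|) {y₀ : ℝ}
    (hy₀ : Y ≤ y₀) (hs₀ : 0 ≤ s y₀) : ∀ y, y₀ ≤ y → 0 ≤ s y := by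
  refine real_induction hs₀ (fun y hy hs => ?_) (fun y hy hP => ?_)
  · have hYy := hy₀.trans hy
    rcases hs.lt_or_eq with hs | hs
    · filter_upwards [((H.right_s y).mono Ioi_subset_Ici_self).eventually_const_lt hs] with z hz
        using hz.le
    -- At `s = 0` also `b = 0`, and `b` leaves 0 with the sign of `d`, as `|d|` exceeds the drift;
    -- then `2 * b = s * d` gives `s ≥ 0`.
    · have hdy := hd y hYy hs.ge
      have hk := _root_.abs_le.1 (hkb y hYy)
      have hB : 0 ≤ B := (abs_nonneg _).trans (hkb y hYy)
      have hb0 : b y = 0 := by have := H.eq_b y; rw [← hs] at this; linarith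
      have hslope := H.deriv_b y hYy
      rw [hasDerivWithinAt_iff_tendsto_slope, Ici_sdiff_left] at hslope
      have hdr := (H.right_d y).mono Ioi_subset_Ici_self
      rcases le_or_gt 0 (d y) with h | h
      · rw [abs_of_nonneg h] at hdy
        filter_upwards [hslope.eventually_const_lt (show 0 < d y - kb y by linarith),
          hdr.eventually_const_lt (show 0 < d y by linarith), self_mem_nhdsWithin]
          with z h1 h2 (h3 : y < z)
        have hbz : 0 < b z := by
          rw [slope_def_field, hb0, sub_zero] at h1
          exact (div_pos_iff_of_pos_right (sub_pos.2 h3)).1 h1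
        have := H.eq_b z
        by_contra! hsz
        nlinarith [mul_pos (neg_pos.2 hsz) h2]
      · rw [abs_of_neg h] at hdy
        filter_upwards [hslope.eventually_lt_const (show d y - kb y < 0 by linarith),
          hdr.eventually_lt_const (show d y < 0 by linarith), self_mem_nhdsWithin]
          with z h1 h2 (h3 : y < z)
        have hbz : b z < 0 := by
          rw [slope_def_field, hb0, sub_zero] at h1
          have h4 := mul_neg_of_neg_of_pos h1 (sub_pos.2 h3)
          rwa [div_mul_cancel₀ _ (sub_pos.2 h3).ne'] at h4
        have := H.eq_b z
        by_contra! hsz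
        nlinarith [mul_pos (neg_pos.2 hsz) (neg_pos.2 h2)]
  · by_contra! hs
    have h1 := ((H.left_s y hs).mono Iio_subset_Iic_self).eventually_lt_const hs
    have h2 : ∀ᶠ z in 𝓝[<] y, z ∈ Ioo y₀ y := Ioo_mem_nhdsLT hy
    obtain ⟨z, hz1, hz2⟩ := (h1.and h2).exists
    exact absurd hz1 (not_lt.2 (hP z ⟨hz2.1.le, hz2.2⟩))

/-- A visit to `s < 0` sends the distance from the equilibrium to infinity. Far out, `s ≤ 0` forces
`a` to be very negative, the clipped part in `b` being bounded, hence `|d|` to be large; so `s`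
returns to nonnegative values, stays there, and `false_of_escape` applies. -/
lemma s_nonneg_of_nonneg (H : BackwardTrajectory Y a b s d ka kb) {σ β η : ℝ} (hσ : 0 < σ)
    (hβ : 0 ≤ β) (hβσ : β ≤ σ) (hη : η ≤ σ / 1000) (hka : ∀ y, Y ≤ y → |ka y - σ| ≤ η)
    (hkb : ∀ y, Y ≤ y → |kb y - β| ≤ η) : ∀ y, Y ≤ y → 0 ≤ s y := by
  by_contra! hcon
  obtain ⟨y₁, hy₁, hneg⟩ := hcon
  have hgrow := H.dist_grows hσ hβ hβσ hη hka hkb hy₁ hneg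
  set a' := (3 * σ ^ 2 - β ^ 2) / 4 with ha'
  set b' := σ * β / 2 with hb'
  have ha'0 : 0 ≤ a' := by rw [ha']; nlinarith
  have hb'0 : 0 ≤ b' := by positivity
  have hka' : ∀ y, Y ≤ y → |ka y| ≤ 2 * σ := fun y hy => by
    have := _root_.abs_le.1 (hka y hy)
    exact _root_.abs_le.2 ⟨by linarith, by linarith⟩
  have hkb' : ∀ y, Y ≤ y → |kb y| ≤ 2 * σ := fun y hy => by
    have := _root_.abs_le.1 (hkb y hy)
    exact _root_.abs_le.2 ⟨by linarith, by linarith⟩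
  have hlarge : ∀ R : ℝ, ∃ T, y₁ ≤ T ∧ ∀ y, T ≤ y →
      R ≤ σ ^ 4 / 4 + σ ^ 3 / 1500 * (y - y₁) := by
    intro R
    refine ⟨y₁ + |R| / (σ ^ 3 / 1500), ?_, fun y hy => ?_⟩
    · have : 0 ≤ |R| / (σ ^ 3 / 1500) := by positivity
      linarith
    · have h1 : |R| / (σ ^ 3 / 1500) ≤ y - y₁ := by linarith
      rw [div_le_iff₀ (by positivity)] at h1
      have := le_abs_self R
      have : 0 < σ ^ 4 := by positivity
      linarith
  -- With this threshold `s ≤ 0` yields `a ≤ -(2 * σ + 1) ^ 2 / 4`, hence `|d| ≥ 2 * σ + 1`.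
  obtain ⟨T, hT, hT'⟩ := hlarge (b' ^ 2 + (a' + (2 * σ + 1) ^ 2 / 4) ^ 2)
  have hd : ∀ y, T ≤ y → s y ≤ 0 → 2 * σ + 1 ≤ |d y| := by
    intro y hy hs
    have h1 := (hT' y hy).trans ((hgrow y (hT.trans hy)).2 hs)
    have hay : a y ≤ 0 := by
      rcases hs.lt_or_eq with h | h
      · exact (H.neg y h).le
      · have := H.eq_a y
        rw [h] at this
        nlinarith [sq_nonneg (d y)]
    have h2 : max (b' - max (b y) 0) 0 ^ 2 ≤ b' ^ 2 := by
      have : max (b' - max (b y) 0) 0 ≤ b' := max_le (by linarith [le_max_right (b y) 0]) hb'0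
      exact pow_le_pow_left₀ (le_max_right _ _) this 2
    have h3 : (a' + (2 * σ + 1) ^ 2 / 4) ^ 2 ≤ (a' - a y) ^ 2 := by
      unfold clippedDist at h1
      nlinarith
    have h4 := le_of_sq_le_sq h3 (by linarith)
    have h5 : (2 * σ + 1) ^ 2 ≤ |d y| ^ 2 := by
      rw [sq_abs]
      nlinarith [H.eq_a y, sq_nonneg (s y)]
    exact le_of_sq_le_sq h5 (abs_nonneg _)
  have HT := H.mono (hy₁.trans hT)
  have hkbT : ∀ y, T ≤ y → |kb y| ≤ 2 * σ := fun y hy => hkb' y ((hy₁.trans hT).trans hy)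
  obtain ⟨y₀, hy₀, hs₀⟩ := HT.exists_s_nonneg hkbT hd
  have hnn := HT.s_nonneg_persists hkbT hd hy₀ hs₀
  refine (HT.mono hy₀).false_of_escape
    (fun y hy => hka' y ((hy₁.trans hT).trans (hy₀.trans hy)))
    (fun y hy => hkbT y (hy₀.trans hy)) hnn fun R => ?_
  obtain ⟨T', hT1, hT2⟩ := hlarge ((|R| + a' + b') ^ 2)
  refine ⟨T', fun y hy => ?_⟩
  have h1 := (hT2 y hy).trans (hgrow y (hT1.trans hy)).1
  have h2 : (a y - a') ^ 2 + (b y - b') ^ 2 ≤ (|a y - a'| + |b y - b'|) ^ 2 := by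
    rw [← sq_abs (a y - a'), ← sq_abs (b y - b')]
    nlinarith [mul_nonneg (abs_nonneg (a y - a')) (abs_nonneg (b y - b'))]
  have h3 := le_of_sq_le_sq (h1.trans h2) (by positivity)
  have h4 := abs_sub (a y) a'
  have h5 := abs_sub (b y) b'
  rw [abs_of_nonneg ha'0] at h4
  rw [abs_of_nonneg hb'0] at h5
  linarith [le_abs_self R]

/-- When the slopes of the costs are nearly constant, the branch `s < 0` is never taken. -/
lemma s_nonneg (H : BackwardTrajectory Y a b s d ka kb) {σ β η : ℝ} (hσ : 0 < σ)
    (hβσ : |β| ≤ σ) (hη : η ≤ σ / 1000) (hka : ∀ y, Y ≤ y → |ka y - σ| ≤ η)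
    (hkb : ∀ y, Y ≤ y → |kb y - β| ≤ η) : ∀ y, Y ≤ y → 0 ≤ s y := by
  rcases le_total 0 β with h | h
  · exact H.s_nonneg_of_nonneg hσ h ((le_abs_self _).trans hβσ) hη hka hkb
  · refine H.flip.s_nonneg_of_nonneg (β := -β) hσ (neg_nonneg.2 h) ((neg_le_abs _).trans hβσ) hη
      hka fun y hy => ?_
    rw [← abs_neg]
    convert! hkb y hy using 2
    ring

/-- Two trajectories with `s ≥ 0` for the same costs coincide, if one of them is bounded and
bounded away from `s = 0`. -/
lemma eq_of_s_nonneg {a' b' s' d' : ℝ → ℝ} (H : BackwardTrajectory Y a b s d ka kb)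
    (H' : BackwardTrajectory Y a' b' s' d' ka kb) {B M m : ℝ} (hm : 0 < m)
    (hka : ∀ y, Y ≤ y → |ka y| ≤ B) (hkb : ∀ y, Y ≤ y → |kb y| ≤ B)
    (hs : ∀ y, Y ≤ y → 0 ≤ s y) (hs' : ∀ y, Y ≤ y → m ≤ s' y)
    (hM : ∀ y, Y ≤ y → |s' y| ≤ M) (hM' : ∀ y, Y ≤ y → |d' y| ≤ M) :
    ∀ y, Y ≤ y → a y = a' y ∧ b y = b' y := by
  set E : ℝ → ℝ := fun t => (a t - a' t) ^ 2 + (b t - b' t) ^ 2 with hE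
  have hcE : Continuous E := by
    have h1 := H.continuous_a
    have h2 := H.continuous_b
    have h3 := H'.continuous_a
    have h4 := H'.continuous_b
    fun_prop
  set E' : ℝ → ℝ := fun t =>
    (s t + s' t) * (3 * (s t - s' t) ^ 2 + (d t - d' t) ^ 2) / 2 with hE'
  have hdE : ∀ t, Y ≤ t → HasDerivWithinAt E (E' t) (Ici t) t := by
    intro t ht
    convert! (((H.deriv_a t ht).sub (H'.deriv_a t ht)).pow 2).add
      (((H.deriv_b t ht).sub (H'.deriv_b t ht)).pow 2) using 1
    have := monotone_identity (H.eq_a t) (H.eq_b t) (H'.eq_a t) (H'.eq_b t)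
    simp only [hE', Pi.sub_apply]
    norm_num
    linear_combination -2 * this
  have hE'0 : ∀ t, Y ≤ t → 0 ≤ E' t := by
    intro t ht
    have h1 := hs t ht
    have h2 := hs' t ht
    have : 0 ≤ s t + s' t := by linarith
    simp only [hE']
    positivity
  have hle : ∀ t, E t ≤ (|a t - a' t| + |b t - b' t|) ^ 2 := by
    intro t
    simp only [hE]
    rw [← sq_abs (a t - a' t), ← sq_abs (b t - b' t)]
    nlinarith [mul_nonneg (abs_nonneg (a t - a' t)) (abs_nonneg (b t - b' t))]
  have hM0 : 0 < M := by
    have h1 := hs' Y le_rfl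
    have h2 := hM Y le_rfl
    linarith [le_abs_self (s' Y)]
  intro y hy
  by_contra hne
  have hE0 : 0 < E y := by
    simp only [hE]
    rcases not_and_or.1 hne with h | h
    · have := pow_pos (abs_pos.2 (sub_ne_zero.2 h)) 2
      rw [sq_abs] at this
      positivity
    · have := pow_pos (abs_pos.2 (sub_ne_zero.2 h)) 2
      rw [sq_abs] at this
      positivity
  have hmono : ∀ t, y ≤ t → E y ≤ E t := by
    intro t ht
    have := add_mul_le_of_right_deriv_ge (c := 0) ht hcE.continuousOn
      (fun z hz => hdE z (hy.trans hz.1)) fun z hz => hE'0 z (hy.trans hz.1)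
    linarith
  set X₀ := √(E y) with hX₀
  have hX₀0 : 0 < X₀ := Real.sqrt_pos.2 hE0
  -- This makes the error `θ * M ^ 2` equal to `X₀ / 2`, so values at distance at least `X₀` have
  -- derivatives whose squared distance is at least `q₀`.
  set θ := X₀ / (2 * M ^ 2) with hθ
  have hθ0 : 0 < θ := by positivity
  set q₀ := X₀ / 2 / (1 + 5 / (4 * θ)) with hq₀
  have hq₀0 : 0 < q₀ := by positivity
  have hq : ∀ t, y ≤ t → q₀ ≤ (s t - s' t) ^ 2 + (d t - d' t) ^ 2 := by
    intro t ht
    have htY := hy.trans ht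
    have h1 := value_dist_le (H.eq_a t) (H.eq_b t) (H'.eq_a t) (H'.eq_b t) (hM t htY)
      (hM' t htY) hθ0
    have h2 : X₀ ≤ |a t - a' t| + |b t - b' t| :=
      Real.sqrt_le_iff.2 ⟨by positivity, (hmono t ht).trans (hle t)⟩
    have h3 : θ * M ^ 2 = X₀ / 2 := by rw [hθ]; field_simp
    rw [hq₀, div_le_iff₀ (by positivity)]
    linarith
  have hrate : ∀ t, y ≤ t → m * q₀ / 2 ≤ E' t := by
    intro t ht
    have htY := hy.trans ht
    have h1 := hs t htY
    have h2 := hs' t htY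
    have h3 := hq t ht
    simp only [hE']
    have : m * q₀ ≤ (s t + s' t) * (3 * (s t - s' t) ^ 2 + (d t - d' t) ^ 2) :=
      mul_le_mul (by linarith) (by linarith [sq_nonneg (s t - s' t)]) hq₀0.le (by linarith)
    linarith
  have hgrow : ∀ t, y ≤ t → E y + m * q₀ / 2 * (t - y) ≤ E t := fun t ht =>
    add_mul_le_of_right_deriv_ge ht hcE.continuousOn
      (fun z hz => hdE z (hy.trans hz.1)) fun z hz => hrate z hz.1
  -- The second trajectory is bounded in `(a', b')`, so linear growth of `E` makes the first one
  -- escape.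
  refine H.false_of_escape hka hkb hs fun R => ?_
  refine ⟨y + (|R| + (2 * M) ^ 2) ^ 2 / (m * q₀ / 2), fun t ht => ?_⟩
  have hyt : y ≤ t := by
    have : 0 ≤ (|R| + (2 * M) ^ 2) ^ 2 / (m * q₀ / 2) := by positivity
    linarith
  have h1 : (|R| + (2 * M) ^ 2) ^ 2 ≤ m * q₀ / 2 * (t - y) := by
    have : (|R| + (2 * M) ^ 2) ^ 2 / (m * q₀ / 2) ≤ t - y := by linarith
    rw [div_le_iff₀ (by positivity)] at this
    linarith
  have h2 := le_of_sq_le_sq ((show (|R| + (2 * M) ^ 2) ^ 2 ≤ E t by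
    linarith [hgrow t hyt]).trans (hle t)) (by positivity)
  have h3 := abs_sub (a t) (a' t)
  have h4 := abs_sub (b t) (b' t)
  have h5 := H'.abs_add_abs_le_sq t
  have h6 : (|s' t| + |d' t|) ^ 2 ≤ (2 * M) ^ 2 :=
    pow_le_pow_left₀ (by positivity) (by linarith [hM t (hy.trans hyt), hM' t (hy.trans hyt)]) 2
  linarith [le_abs_self R]

end BackwardTrajectory

/-! ### From admissible solutions to one-sided derivatives. -/

lemma tendsto_of_tendsto_limits {g r : ℝ → ℝ} {A D : Set ℝ} {y L : ℝ} (hA : IsOpen A)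
    (hL : Tendsto g (𝓝[A ∩ D] y) (𝓝 L))
    (hr : ∀ z ∈ A, ∃ l : Filter ℝ, l.NeBot ∧ l ≤ 𝓝[D] z ∧ Tendsto g l (𝓝 (r z))) :
    Tendsto r (𝓝[A] y) (𝓝 L) := by
  -- Closed neighbourhoods are used because `r z` is only a limit of values of `g` lying in them.
  refine (closed_nhds_basis L).tendsto_right_iff.2 fun N ⟨hN, hNc⟩ => ?_
  obtain ⟨O, hO, hyO, hON⟩ := mem_nhdsWithin.1 (hL hN)
  filter_upwards [inter_mem_nhdsWithin A (hO.mem_nhds hyO)] with z ⟨hzA, hzO⟩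
  obtain ⟨l, hl, hlD, hlim⟩ := hr z hzA
  refine hNc.mem_of_tendsto hlim (hlD ?_)
  filter_upwards [inter_mem_nhdsWithin D ((hO.inter hA).mem_nhds ⟨hzO, hzA⟩)] with t ht
  exact hON ⟨ht.2.1, ht.2.2, ht.1⟩

/-- Absolute continuity makes the increment of `f` the integral of `deriv f`, so a limit of the
derivative is a one-sided derivative. The condition on `A` is almost everywhere because `uIoc y z`
contains `y` when `z < y`. -/
lemma hasDerivWithinAt_of_tendsto_deriv_ae {f : ℝ → ℝ} {A D : Set ℝ} {y L : ℝ}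
    (hf : ∀ a b, AbsolutelyContinuousOnInterval f a b)
    (hD : ∀ᵐ t, t ∈ D) (hA : ∀ z ∈ A, ∀ᵐ t, t ∈ uIoc y z → t ∈ A)
    (hL : Tendsto (deriv f) (𝓝[A ∩ D] y) (𝓝 L)) : HasDerivWithinAt f L A y := by
  rw [hasDerivWithinAt_iff_isLittleO, Asymptotics.isLittleO_iff]
  intro c hc
  have hev : ∀ᶠ t in 𝓝[A ∩ D] y, |deriv f t - L| ≤ c := by
    filter_upwards [hL (Metric.closedBall_mem_nhds L hc)] with t ht
    simpa [Real.dist_eq] using ht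
  obtain ⟨ε, hε, hball⟩ := Metric.mem_nhdsWithin_iff.1 hev
  filter_upwards [inter_mem_nhdsWithin A (Metric.ball_mem_nhds y hε)] with z ⟨hzA, hzε⟩
  have hint := (hf y z).integral_deriv_eq_sub
  have hi := (hf y z).intervalIntegrable_deriv
  have : f z - f y - (z - y) • L = ∫ t in y..z, (deriv f t - L) := by
    rw [intervalIntegral.integral_sub hi intervalIntegrable_const, hint,
      intervalIntegral.integral_const]
  rw [this]
  refine intervalIntegral.norm_integral_le_of_norm_le_const_ae ?_
  filter_upwards [hA z hzA, hD] with t h1 h2 h3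
  refine hball ⟨?_, h1 h3, h2⟩
  rw [Metric.mem_ball, Real.dist_eq] at hzε ⊢
  refine lt_of_le_of_lt ?_ hzε
  have := uIoc_subset_uIcc h3
  rcases le_total y z with h | h
  · rw [uIcc_of_le h] at this
    rw [abs_of_nonneg (by linarith [this.1]), abs_of_nonneg (by linarith)]; linarith [this.2]
  · rw [uIcc_of_ge h] at this
    rw [abs_of_nonpos (by linarith [this.2]), abs_of_nonpos (by linarith)]; linarith [this.1]

/-- The one-sided derivatives of a solution, in the coordinates `U = u₀ + u₁`, `W = u₀ - u₁`. -/
structure Trajectory (H J U W sr dr sl dl : ℝ → ℝ) : Prop where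
  continuous_U : Continuous U
  continuous_W : Continuous W
  deriv_U_right : ∀ x, HasDerivWithinAt U (sr x) (Ici x) x
  deriv_W_right : ∀ x, HasDerivWithinAt W (dr x) (Ici x) x
  deriv_U_left : ∀ x, HasDerivWithinAt U (sl x) (Iic x) x
  deriv_W_left : ∀ x, HasDerivWithinAt W (dl x) (Iic x) x
  eq_a_right : ∀ x, 4 * (H x - U x) = 3 * sr x ^ 2 - dr x ^ 2
  eq_b_right : ∀ x, 2 * (J x - W x) = sr x * dr x
  eq_a_left : ∀ x, 4 * (H x - U x) = 3 * sl x ^ 2 - dl x ^ 2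
  eq_b_left : ∀ x, 2 * (J x - W x) = sl x * dl x
  right_sr : ∀ x, Tendsto sr (𝓝[>] x) (𝓝 (sr x))
  right_sl : ∀ x, Tendsto sl (𝓝[>] x) (𝓝 (sr x))
  left_sr : ∀ x, Tendsto sr (𝓝[<] x) (𝓝 (sl x))
  left_sl : ∀ x, Tendsto sl (𝓝[<] x) (𝓝 (sl x))
  left_dl : ∀ x, Tendsto dl (𝓝[<] x) (𝓝 (dl x))
  jump : ∀ x, sl x < 0 → sr x = sl x
  growth : ∃ K, ∀ x, |U x| + |W x| ≤ K * (1 + |x|)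

/-- The system determines the derivatives up to a common sign. -/
lemma eq_or_eq_neg_of_hj {s d s' d' : ℝ} (h1 : 3 * s ^ 2 - d ^ 2 = 3 * s' ^ 2 - d' ^ 2)
    (h2 : s * d = s' * d') : (s = s' ∧ d = d') ∨ (s = -s' ∧ d = -d') := by
  have h3 : 3 * s ^ 2 + d ^ 2 = 3 * s' ^ 2 + d' ^ 2 := by
    refine (pow_left_inj₀ (by positivity) (by positivity) two_ne_zero).1 ?_
    linear_combination (3 * s ^ 2 - d ^ 2 + (3 * s' ^ 2 - d' ^ 2)) * h1
      + 12 * (s * d + s' * d') * h2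
  have h4 : s ^ 2 = s' ^ 2 := by linarith
  have h5 : d ^ 2 = d' ^ 2 := by linarith
  rcases sq_eq_sq_iff_eq_or_eq_neg.1 h4 with hs | hs <;>
  rcases sq_eq_sq_iff_eq_or_eq_neg.1 h5 with hd | hd
  · exact Or.inl ⟨hs, hd⟩
  · have : s' * d' = 0 := by rw [hs, hd] at h2; linarith
    rcases mul_eq_zero.1 this with h | h
    · right; rw [hs, h, hd]; simp
    · left; rw [hd, h, hs]; simp
  · have : s' * d' = 0 := by rw [hs, hd] at h2; linarith
    rcases mul_eq_zero.1 this with h | h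
    · left; rw [hs, h, hd]; simp
    · right; rw [hd, h, hs]; simp
  · exact Or.inr ⟨hs, hd⟩

lemma SatisfiesHJ.eq_a {h : Fin 2 → ℝ → ℝ} {t : ℝ} {v p : Fin 2 → ℝ} (H : SatisfiesHJ h t v p) :
    4 * (h 0 t + h 1 t - (v 0 + v 1)) = 3 * (p 0 + p 1) ^ 2 - (p 0 - p 1) ^ 2 := by
  rw [H.1, H.2]; ring

lemma SatisfiesHJ.eq_b {h : Fin 2 → ℝ → ℝ} {t : ℝ} {v p : Fin 2 → ℝ} (H : SatisfiesHJ h t v p) :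
    2 * (h 0 t - h 1 t - (v 0 - v 1)) = (p 0 + p 1) * (p 0 - p 1) := by
  rw [H.1, H.2]; ring

lemma satisfiesHJ_of_tendsto {h u : Fin 2 → ℝ → ℝ} {y : ℝ} {l : Filter ℝ} [l.NeBot]
    {p : Fin 2 → ℝ} (hh : ∀ i, Continuous (h i)) (hu : ∀ i, Continuous (u i)) (hl : l ≤ 𝓝 y)
    (hHJ : ∀ᶠ t in l, SatisfiesHJ h t (fun i => u i t) (fun i => deriv (u i) t))
    (hp : ∀ i, Tendsto (deriv (u i)) l (𝓝 (p i))) : SatisfiesHJ h y (fun i => u i y) p := by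
  have h1 : ∀ i, Tendsto (h i) l (𝓝 (h i y)) := fun i => (hh i).continuousAt.mono_left hl
  have h2 : ∀ i, Tendsto (u i) l (𝓝 (u i y)) := fun i => (hu i).continuousAt.mono_left hl
  constructor
  · refine tendsto_nhds_unique ((h2 0).congr' (hHJ.mono fun t ht => ht.1)) ?_
    exact ((h1 0).sub ((hp 0).mul (hp 1))).sub (((hp 0).pow 2).div_const 2)
  · refine tendsto_nhds_unique ((h2 1).congr' (hHJ.mono fun t ht => ht.2)) ?_
    exact ((h1 1).sub ((hp 0).mul (hp 1))).sub (((hp 1).pow 2).div_const 2)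

lemma neBot_nhdsWithin_inter_of_ae {A D : Set ℝ} {y : ℝ} (hD : ∀ᵐ t, t ∈ D) (hA : IsOpen A)
    (hy : y ∈ closure A) : (𝓝[A ∩ D] y).NeBot := by
  have hdense : Dense D := Measure.dense_of_ae hD
  rw [← mem_closure_iff_nhdsWithin_neBot]
  exact closure_minimal (hdense.open_subset_closure_inter hA) isClosed_closure hy

/-- One-sided limits along the conull set `D` give the system at every point, for left and right
derivatives alike. Hence the two agree up to a common sign (`eq_or_eq_neg_of_hj`), and the jump
condition forbids passing from negative to positive `s`. -/
lemma IsAdmissible.exists_trajectory {h u : Fin 2 → ℝ → ℝ} (hh : ∀ i, Continuous (h i))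
    (hu : IsAdmissible h u) : ∃ sr dr sl dl, Trajectory (fun x => h 0 x + h 1 x)
      (fun x => h 0 x - h 1 x) (fun x => u 0 x + u 1 x) (fun x => u 0 x - u 1 x) sr dr sl dl := by
  choose pr pl hpr hpl hj using hu.jumps
  set D : Set ℝ := {t | (∀ i : Fin 2, DifferentiableAt ℝ (u i) t) ∧
    SatisfiesHJ h t (fun i => u i t) (fun i => deriv (u i) t)} with hD
  have haeD : ∀ᵐ t, t ∈ D := hu.equation
  have hcu : ∀ i, Continuous (u i) := by
    intro i
    refine continuous_iff_continuousAt.2 fun x => ?_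
    refine (hu.absolutelyContinuous i (x - 1) (x + 1)).continuousOn.continuousAt ?_
    rw [uIcc_of_le (by linarith)]
    exact Icc_mem_nhds (by linarith) (by linarith)
  have hr : ∀ i y, Tendsto (deriv (u i)) (𝓝[Ioi y ∩ D] y) (𝓝 (pr y i)) := fun i y =>
    (hpr y i).mono_left (nhdsWithin_mono y fun t ht => ⟨ht.1, ht.2.1 i⟩)
  have hl : ∀ i y, Tendsto (deriv (u i)) (𝓝[Iio y ∩ D] y) (𝓝 (pl y i)) := fun i y =>
    (hpl y i).mono_left (nhdsWithin_mono y fun t ht => ⟨ht.1, ht.2.1 i⟩)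
  have nbr : ∀ y, (𝓝[Ioi y ∩ D] y).NeBot := fun y =>
    neBot_nhdsWithin_inter_of_ae haeD isOpen_Ioi (by simp)
  have nbl : ∀ y, (𝓝[Iio y ∩ D] y).NeBot := fun y =>
    neBot_nhdsWithin_inter_of_ae haeD isOpen_Iio (by simp)
  have hHJr : ∀ y, SatisfiesHJ h y (fun i => u i y) (pr y) := fun y =>
    satisfiesHJ_of_tendsto (l := 𝓝[Ioi y ∩ D] y) hh hcu nhdsWithin_le_nhds
      (by filter_upwards [self_mem_nhdsWithin] with t ht using ht.2.2) fun i => hr i y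
  have hHJl : ∀ y, SatisfiesHJ h y (fun i => u i y) (pl y) := fun y =>
    satisfiesHJ_of_tendsto (l := 𝓝[Iio y ∩ D] y) hh hcu nhdsWithin_le_nhds
      (by filter_upwards [self_mem_nhdsWithin] with t ht using ht.2.2) fun i => hl i y
  have hdr : ∀ i y, HasDerivWithinAt (u i) (pr y i) (Ici y) y := fun i y => by
    rw [← hasDerivWithinAt_Ioi_iff_Ici]
    refine hasDerivWithinAt_of_tendsto_deriv_ae (hu.absolutelyContinuous i) haeD
      (fun z hz => Eventually.of_forall fun t ht => ?_) (hr i y)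
    rw [uIoc_of_le (le_of_lt hz)] at ht
    exact ht.1
  have hdl : ∀ i y, HasDerivWithinAt (u i) (pl y i) (Iic y) y := fun i y => by
    rw [← hasDerivWithinAt_Iio_iff_Iic]
    refine hasDerivWithinAt_of_tendsto_deriv_ae (hu.absolutelyContinuous i) haeD
      (fun z hz => ?_) (hl i y)
    filter_upwards [compl_mem_ae_iff.2 (measure_singleton y)] with t hty ht
    rw [uIoc_of_ge (le_of_lt hz)] at ht
    exact lt_of_le_of_ne ht.2 hty
  have hlr : ∀ i z, ∃ l : Filter ℝ, l.NeBot ∧ l ≤ 𝓝[D] z ∧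
      Tendsto (deriv (u i)) l (𝓝 (pr z i)) := fun i z =>
    ⟨_, nbr z, nhdsWithin_mono z inter_subset_right, hr i z⟩
  have hll : ∀ i z, ∃ l : Filter ℝ, l.NeBot ∧ l ≤ 𝓝[D] z ∧
      Tendsto (deriv (u i)) l (𝓝 (pl z i)) := fun i z =>
    ⟨_, nbl z, nhdsWithin_mono z inter_subset_right, hl i z⟩
  have hrr : ∀ i y, Tendsto (fun z => pr z i) (𝓝[>] y) (𝓝 (pr y i)) := fun i y =>
    tendsto_of_tendsto_limits isOpen_Ioi (hr i y) fun z _ => hlr i z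
  have hrl : ∀ i y, Tendsto (fun z => pl z i) (𝓝[>] y) (𝓝 (pr y i)) := fun i y =>
    tendsto_of_tendsto_limits isOpen_Ioi (hr i y) fun z _ => hll i z
  have hlr : ∀ i y, Tendsto (fun z => pr z i) (𝓝[<] y) (𝓝 (pl y i)) := fun i y =>
    tendsto_of_tendsto_limits isOpen_Iio (hl i y) fun z _ => hlr i z
  have hll : ∀ i y, Tendsto (fun z => pl z i) (𝓝[<] y) (𝓝 (pl y i)) := fun i y =>
    tendsto_of_tendsto_limits isOpen_Iio (hl i y) fun z _ => hll i z
  refine ⟨fun x => pr x 0 + pr x 1, fun x => pr x 0 - pr x 1, fun x => pl x 0 + pl x 1,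
    fun x => pl x 0 - pl x 1, ?_⟩
  exact
  { continuous_U := (hcu 0).add (hcu 1)
    continuous_W := (hcu 0).sub (hcu 1)
    deriv_U_right := fun x => (hdr 0 x).add (hdr 1 x)
    deriv_W_right := fun x => (hdr 0 x).sub (hdr 1 x)
    deriv_U_left := fun x => (hdl 0 x).add (hdl 1 x)
    deriv_W_left := fun x => (hdl 0 x).sub (hdl 1 x)
    eq_a_right := fun x => (hHJr x).eq_a
    eq_b_right := fun x => (hHJr x).eq_b
    eq_a_left := fun x => (hHJl x).eq_a
    eq_b_left := fun x => (hHJl x).eq_b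
    right_sr := fun x => (hrr 0 x).add (hrr 1 x)
    right_sl := fun x => (hrl 0 x).add (hrl 1 x)
    left_sr := fun x => (hlr 0 x).add (hlr 1 x)
    left_sl := fun x => (hll 0 x).add (hll 1 x)
    left_dl := fun x => (hll 0 x).sub (hll 1 x)
    jump := by
      intro x hx
      by_cases hp : pr x = pl x
      · rw [hp]
      · have h1 := (hHJr x).eq_a.symm.trans (hHJl x).eq_a
        have h2 := (hHJr x).eq_b.symm.trans (hHJl x).eq_b
        rcases eq_or_eq_neg_of_hj h1 h2 with h3 | h3
        · exact h3.1
        · rcases hj x hp with h4 | h4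
          · linarith [h3.1]
          · linarith
    growth := by
      obtain ⟨K, hK⟩ := hu.growth
      refine ⟨4 * K, fun x => ?_⟩
      have h0 := hK 0 x
      have h1 := hK 1 x
      have h2 := abs_add_le (u 0 x) (u 1 x)
      have h3 := abs_sub (u 0 x) (u 1 x)
      linarith }

/-! ### Forward escape: negative `s` forces negative `H - U`. -/

namespace Trajectory

variable {H J U W sr dr sl dl : ℝ → ℝ}

/-- While `s < 0`, `U` decreases and `H` increases, so `H - U` becomes positive. Then `s` cannot
reach 0, since `4 * (H - U) ≤ 3 * s ^ 2`, and it cannot jump from a negative value. -/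
lemma sr_neg_of_pos (T : Trajectory H J U W sr dr sl dl) {c : ℝ} (hc : 0 < c)
    (hH : ∀ y z, y ≤ z → c * (z - y) ≤ H z - H y) {x : ℝ} (hs : sr x < 0) (ha : 0 ≤ H x - U x) :
    ∀ z, x ≤ z → sr z < 0 ∧ 0 ≤ H z - U z := by
  refine real_induction (P := fun z => sr z < 0 ∧ 0 ≤ H z - U z) ⟨hs, ha⟩ ?_ ?_
  · rintro y - ⟨hy1, hy2⟩
    have hcw : ContinuousWithinAt sr (Ici y) y := continuousWithinAt_Ioi_iff_Ici.1 (T.right_sr y)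
    obtain ⟨u, hu, hu'⟩ := mem_nhdsGE_iff_exists_Ico_subset.1 (hcw.eventually_lt_const hy1)
    filter_upwards [Ioo_mem_nhdsGT hu] with z hz
    refine ⟨hu' ⟨hz.1.le, hz.2⟩, ?_⟩
    have h1 := add_mul_le_of_right_deriv_ge (f := fun t => -U t) (f' := fun t => -sr t) (c := 0)
      hz.1.le T.continuous_U.neg.continuousOn (fun t _ => (T.deriv_U_right t).neg)
      (fun t ht => (neg_pos.2 (hu' ⟨ht.1, ht.2.trans hz.2⟩ : sr t < 0)).le)
    have h2 := hH y z hz.1.le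
    have h3 : 0 ≤ c * (z - y) := mul_nonneg hc.le (by linarith [hz.1])
    linarith
  · intro y hy hP
    have hev : ∀ᶠ z in 𝓝[<] y, z ∈ Ico x y := by
      filter_upwards [Ioo_mem_nhdsLT hy] with z hz using ⟨hz.1.le, hz.2⟩
    have h1 := add_mul_le_of_right_deriv_ge (f := fun t => -U t) (f' := fun t => -sr t) (c := 0)
      hy.le T.continuous_U.neg.continuousOn (fun t _ => (T.deriv_U_right t).neg)
      (fun t ht => (neg_pos.2 (hP t ht).1).le)
    have h2 := hH x y hy.le
    have h3 : 0 < c * (y - x) := mul_pos hc (sub_pos.2 hy)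
    have hapos : 0 < H y - U y := by linarith
    have hle : sl y ≤ 0 := le_of_tendsto (T.left_sr y) (hev.mono fun z hz => (hP z hz).1.le)
    have hlt : sl y < 0 := by
      refine lt_of_le_of_ne hle fun h0 => ?_
      have := T.eq_a_left y
      rw [h0] at this
      nlinarith [sq_nonneg (dl y)]
    rw [T.jump y hlt]
    exact ⟨hlt, hapos.le⟩

/-- The branch `s < 0` with `H - U ≥ 0` escapes to infinity forwards. -/
lemma sub_neg_of_sr_neg (T : Trajectory H J U W sr dr sl dl) {c C : ℝ} (hc : 0 < c)
    (hH : ∀ y z, y ≤ z → c * (z - y) ≤ H z - H y ∧ H z - H y ≤ C * (z - y)) {x : ℝ}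
    (hs : sr x < 0) : H x - U x < 0 := by
  by_contra! ha
  have hneg := T.sr_neg_of_pos hc (fun y z h => (hH y z h).1) hs ha
  have hrate : ∀ (m y z : ℝ), x ≤ y → y ≤ z → (∀ t ∈ Ico y z, m ≤ -sr t) →
      H y - U y + (c + m) * (z - y) ≤ H z - U z := by
    intro m y z _ hyz hm
    have h1 := add_mul_le_of_right_deriv_ge (f := fun t => -U t) (f' := fun t => -sr t)
      hyz T.continuous_U.neg.continuousOn (fun t _ => (T.deriv_U_right t).neg) hm
    have h2 := (hH y z hyz).1
    linarith
  refine false_of_superlinear (f := fun z => H z - U z) (Y := x) ?_ ?_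
  · obtain ⟨K, hK⟩ := T.growth
    refine ⟨|K| + |C| + |H x| + |C| * |x|, fun y hy => ?_⟩
    have h1 := (hH x y hy).2
    have h2 := hK y
    have h3 : C * (y - x) ≤ |C| * (|y| + |x|) := by
      refine (mul_le_mul_of_nonneg_right (le_abs_self C) (by linarith)).trans ?_
      refine mul_le_mul_of_nonneg_left ?_ (abs_nonneg C)
      linarith [le_abs_self y, neg_abs_le x]
    have h4 : K * (1 + |y|) ≤ |K| * (1 + |y|) :=
      mul_le_mul_of_nonneg_right (le_abs_self K) (by positivity)
    have h5 := neg_abs_le (U y)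
    have h6 := abs_nonneg (W y)
    have h7 := le_abs_self (H x)
    have h8 : 0 ≤ |H x| * |y| := by positivity
    have h9 : 0 ≤ |C| * |x| * |y| := by positivity
    have h10 := abs_nonneg C
    show H y - U y ≤ _
    nlinarith
  · intro M
    -- `H - U` grows at rate at least `c`, so it is at least `M ^ 2` past `T₀`, where the equation
    -- gives `-s ≥ M`.
    set T₀ := x + M ^ 2 / c with hT₀
    have hxT : x ≤ T₀ := by have : 0 ≤ M ^ 2 / c := by positivity
                            linarith
    refine ⟨T₀, hxT, fun y hy => ?_⟩
    have h1 := hrate M T₀ y hxT hy (fun t ht => ?_)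
    · have : 0 ≤ c * (y - T₀) := mul_nonneg hc.le (by linarith)
      show H T₀ - U T₀ + _ ≤ H y - U y
      linarith
    · have hxt : x ≤ t := hxT.trans ht.1
      have h2 := hrate 0 x t le_rfl hxt fun z hz => (neg_pos.2 (hneg z hz.1).1).le
      have h3 : M ^ 2 ≤ c * (t - x) := by
        have : M ^ 2 / c ≤ t - x := by linarith [ht.1]
        rw [div_le_iff₀ hc] at this
        linarith
      have h4 := T.eq_a_right t
      have h5 : M ^ 2 ≤ (-sr t) ^ 2 := by nlinarith [sq_nonneg (dr t), sq_nonneg (sr t)]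
      exact le_of_sq_le_sq h5 (neg_pos.2 (hneg t hxt).1).le

lemma sub_neg_of_sl_neg (T : Trajectory H J U W sr dr sl dl) {c C : ℝ} (hc : 0 < c)
    (hH : ∀ y z, y ≤ z → c * (z - y) ≤ H z - H y ∧ H z - H y ≤ C * (z - y)) {x : ℝ}
    (hs : sl x < 0) : H x - U x < 0 :=
  T.sub_neg_of_sr_neg hc hH (by rwa [T.jump x hs])

end Trajectory

/-! ### Time reversal and uniqueness. -/

lemma tendsto_neg_nhdsLT (x : ℝ) : Tendsto (fun y : ℝ => -y) (𝓝[<] x) (𝓝[>] (-x)) :=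
  tendsto_nhdsWithin_of_tendsto_nhds_of_eventually_within _
    (continuous_neg.continuousAt.mono_left nhdsWithin_le_nhds)
    (by filter_upwards [self_mem_nhdsWithin] with z hz using neg_lt_neg (mem_Iio.1 hz))

lemma tendsto_neg_nhdsGT (x : ℝ) : Tendsto (fun y : ℝ => -y) (𝓝[>] x) (𝓝[<] (-x)) :=
  tendsto_nhdsWithin_of_tendsto_nhds_of_eventually_within _
    (continuous_neg.continuousAt.mono_left nhdsWithin_le_nhds)
    (by filter_upwards [self_mem_nhdsWithin] with z hz using neg_lt_neg (mem_Ioi.1 hz))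

lemma hasDerivWithinAt_comp_neg {f : ℝ → ℝ} {f' y : ℝ} (hf : HasDerivWithinAt f f' (Iic (-y)) (-y)) :
    HasDerivWithinAt (fun z => f (-z)) (-f') (Ici y) y := by
  have := hf.scomp y (hasDerivAt_neg y).hasDerivWithinAt (s := Ici y)
    (fun z (hz : y ≤ z) => neg_le_neg hz)
  simpa [Function.comp_def] using this

lemma abs_le_linear_of_slopes {f : ℝ → ℝ} {C : ℝ}
    (hf : ∀ y z, y ≤ z → |f z - f y| ≤ C * (z - y)) (x : ℝ) : |f x| ≤ |f 0| + C * |x| := by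
  have h1 : |f x - f 0| ≤ C * |x| := by
    rcases le_total 0 x with h | h
    · simpa [abs_of_nonneg h] using hf 0 x h
    · rw [abs_sub_comm]
      simpa [abs_of_nonpos h] using hf x 0 h
  have h2 := abs_sub_abs_le_abs_sub (f x) (f 0)
  linarith

namespace Trajectory

variable {H J U W sr dr sl dl : ℝ → ℝ}

/-- Left derivatives turn into right derivatives in reversed time, hence the use of `sl` and `dl`;
the jump condition supplies `left_s`. -/
lemma backward (T : Trajectory H J U W sr dr sl dl) {c C X : ℝ} (hc : 0 < c)
    (hHc : Continuous H) (hJc : Continuous J)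
    (hH : ∀ y z, y ≤ z → c * (z - y) ≤ H z - H y ∧ H z - H y ≤ C * (z - y))
    (hJ : ∀ y z, y ≤ z → |J z - J y| ≤ C * (z - y))
    (hHd : ∀ x ≤ X, DifferentiableAt ℝ H x) (hJd : ∀ x ≤ X, DifferentiableAt ℝ J x) :
    BackwardTrajectory (-X) (fun y => H (-y) - U (-y)) (fun y => J (-y) - W (-y))
      (fun y => sl (-y)) (fun y => dl (-y)) (fun y => deriv H (-y)) (fun y => deriv J (-y)) where
  continuous_a := (hHc.comp continuous_neg).sub (T.continuous_U.comp continuous_neg)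
  continuous_b := (hJc.comp continuous_neg).sub (T.continuous_W.comp continuous_neg)
  deriv_a y hy := by
    have h1 := hasDerivWithinAt_comp_neg
      (hHd (-y) (by linarith)).hasDerivAt.hasDerivWithinAt
    convert! h1.sub (hasDerivWithinAt_comp_neg (T.deriv_U_left (-y))) using 1
    ring
  deriv_b y hy := by
    have h1 := hasDerivWithinAt_comp_neg
      (hJd (-y) (by linarith)).hasDerivAt.hasDerivWithinAt
    convert! h1.sub (hasDerivWithinAt_comp_neg (T.deriv_W_left (-y))) using 1
    ring
  eq_a y := T.eq_a_left (-y)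
  eq_b y := T.eq_b_left (-y)
  right_s y := continuousWithinAt_Ioi_iff_Ici.1 ((T.left_sl (-y)).comp (tendsto_neg_nhdsGT y))
  right_d y := continuousWithinAt_Ioi_iff_Ici.1 ((T.left_dl (-y)).comp (tendsto_neg_nhdsGT y))
  left_s y hy := by
    refine continuousWithinAt_Iio_iff_Iic.1 ?_
    have := (T.right_sl (-y)).comp (tendsto_neg_nhdsLT y)
    rw [T.jump (-y) hy] at this
    exact this
  neg y hy := T.sub_neg_of_sl_neg hc hH hy
  growth := by
    obtain ⟨K, hK⟩ := T.growth
    have hC : 0 ≤ C := by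
      have := (abs_nonneg _).trans (hJ 0 1 zero_le_one)
      linarith
    refine ⟨|K| + 2 * C + |H 0| + |J 0|, fun y => ?_⟩
    have h1 := hK (-y)
    have h2 := abs_le_linear_of_slopes (fun y z h => by
      rw [abs_of_nonneg ((mul_nonneg hc.le (sub_nonneg.2 h)).trans (hH y z h).1)]
      exact (hH y z h).2) (-y)
    have h3 := abs_le_linear_of_slopes hJ (-y)
    rw [abs_neg] at h1 h2 h3
    have h4 : K * (1 + |y|) ≤ |K| * (1 + |y|) :=
      mul_le_mul_of_nonneg_right (le_abs_self K) (by positivity)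
    have h5 := abs_sub (H (-y)) (U (-y))
    have h6 := abs_sub (J (-y)) (W (-y))
    have h7 : 0 ≤ |H 0| * |y| := by positivity
    have h8 : 0 ≤ |J 0| * |y| := by positivity
    nlinarith

/-- Two trajectories that agree at a point, one of them with `s > 0`, agree afterwards. -/
lemma eq_forward {U' W' sr' dr' sl' dl' : ℝ → ℝ} (T : Trajectory H J U W sr dr sl dl)
    (T' : Trajectory H J U' W' sr' dr' sl' dl') {c C : ℝ} (hc : 0 < c)
    (hH : ∀ y z, y ≤ z → c * (z - y) ≤ H z - H y ∧ H z - H y ≤ C * (z - y))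
    (ha' : ∀ x, 0 < H x - U' x) (hs' : ∀ x, 0 ≤ sr' x) {X : ℝ} (hU : U X = U' X)
    (hW : W X = W' X) : ∀ x, X ≤ x → U x = U' x ∧ W x = W' x := by
  have hc1 := T.continuous_U
  have hc2 := T.continuous_W
  have hc3 := T'.continuous_U
  have hc4 := T'.continuous_W
  refine real_induction (P := fun x => U x = U' x ∧ W x = W' x) ⟨hU, hW⟩ ?_ ?_
  · rintro x - ⟨hxU, hxW⟩
    have hax := ha' x
    rw [← hxU] at hax
    -- Agreement at `x` gives `H - U > 0`, which excludes `s ≤ 0`; by right continuity `s > 0` just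
    -- after `x`, where the distance cannot increase.
    have hsr : 0 < sr x := by
      rcases lt_trichotomy (sr x) 0 with h | h | h
      · exact absurd (T.sub_neg_of_sr_neg hc hH h) (not_lt.2 hax.le)
      · have := T.eq_a_right x
        rw [h] at this
        nlinarith [sq_nonneg (dr x)]
      · exact h
    have hcw : ContinuousWithinAt sr (Ici x) x := continuousWithinAt_Ioi_iff_Ici.1 (T.right_sr x)
    have hd : ∀ t, x ≤ t → HasDerivWithinAt (fun t => -((U t - U' t) ^ 2 + (W t - W' t) ^ 2))
        ((sr t + sr' t) * (3 * (sr t - sr' t) ^ 2 + (dr t - dr' t) ^ 2) / 2) (Ici t) t := by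
      intro t _
      convert! ((((T.deriv_U_right t).sub (T'.deriv_U_right t)).pow 2).add
        (((T.deriv_W_right t).sub (T'.deriv_W_right t)).pow 2)).neg using 1
      have := monotone_identity (T.eq_a_right t) (T.eq_b_right t) (T'.eq_a_right t)
        (T'.eq_b_right t)
      simp only [Pi.sub_apply]
      norm_num
      linear_combination -2 * this
    have := eventually_add_mul_le_of_right_deriv_ge (c := 0) (by fun_prop) hd le_rfl (by
      filter_upwards [hcw.eventually_const_lt hsr] with t ht
      have := hs' t
      have : 0 ≤ sr t + sr' t := by linarith
      positivity)
    filter_upwards [this] with z hz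
    rw [hxU, hxW] at hz
    have h1 : (U z - U' z) ^ 2 = 0 := by nlinarith [sq_nonneg (U z - U' z), sq_nonneg (W z - W' z)]
    have h2 : (W z - W' z) ^ 2 = 0 := by nlinarith [sq_nonneg (U z - U' z), sq_nonneg (W z - W' z)]
    exact ⟨sub_eq_zero.1 (pow_eq_zero_iff two_ne_zero |>.1 h1),
      sub_eq_zero.1 (pow_eq_zero_iff two_ne_zero |>.1 h2)⟩
  · intro y hy hP
    have hev : ∀ᶠ z in 𝓝[<] y, z ∈ Ico X y := by
      filter_upwards [Ioo_mem_nhdsLT hy] with z hz using ⟨hz.1.le, hz.2⟩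
    exact ⟨tendsto_nhds_unique_of_eventuallyEq (hc1.continuousWithinAt (s := Iio y))
        (hc3.continuousWithinAt (s := Iio y)) (hev.mono fun z hz => (hP z hz).1),
      tendsto_nhds_unique_of_eventuallyEq (hc2.continuousWithinAt (s := Iio y))
        (hc4.continuousWithinAt (s := Iio y)) (hev.mono fun z hz => (hP z hz).2)⟩

/-- Uniqueness, given one trajectory bounded and bounded away from `s = 0`. -/
lemma unique {U' W' sr' dr' sl' dl' : ℝ → ℝ} (T : Trajectory H J U W sr dr sl dl)
    (T' : Trajectory H J U' W' sr' dr' sl' dl') {c C X σ β η m M : ℝ} (hc : 0 < c)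
    (hHc : Continuous H) (hJc : Continuous J)
    (hH : ∀ y z, y ≤ z → c * (z - y) ≤ H z - H y ∧ H z - H y ≤ C * (z - y))
    (hJ : ∀ y z, y ≤ z → |J z - J y| ≤ C * (z - y))
    (hHd : ∀ x ≤ X, DifferentiableAt ℝ H x) (hJd : ∀ x ≤ X, DifferentiableAt ℝ J x)
    (hσ : 0 < σ) (hβσ : |β| ≤ σ) (hη : η ≤ σ / 1000) (hka : ∀ x ≤ X, |deriv H x - σ| ≤ η)
    (hkb : ∀ x ≤ X, |deriv J x - β| ≤ η) (hm : 0 < m) (ha' : ∀ x, 0 < H x - U' x)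
    (hsr' : ∀ x, 0 ≤ sr' x) (hsl' : ∀ x, m ≤ sl' x) (hsM : ∀ x, |sl' x| ≤ M)
    (hdM : ∀ x, |dl' x| ≤ M) : U = U' ∧ W = W' := by
  have B := T.backward hc hHc hJc hH hJ hHd hJd
  have B' := T'.backward hc hHc hJc hH hJ hHd hJd
  have hka' : ∀ y, -X ≤ y → |deriv H (-y) - σ| ≤ η := fun y hy => hka (-y) (by linarith)
  have hkb' : ∀ y, -X ≤ y → |deriv J (-y) - β| ≤ η := fun y hy => hkb (-y) (by linarith)
  have hs := B.s_nonneg hσ hβσ hη hka' hkb'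
  have hβ := abs_le.1 hβσ
  have heq := B.eq_of_s_nonneg B' (B := 2 * σ) hm
    (fun y hy => by
      have := abs_le.1 (hka' y hy)
      exact abs_le.2 ⟨by linarith, by linarith⟩)
    (fun y hy => by
      have := abs_le.1 (hkb' y hy)
      exact abs_le.2 ⟨by linarith, by linarith⟩)
    hs (fun y _ => hsl' (-y)) (fun y _ => hsM (-y)) (fun y _ => hdM (-y))
  have hback : ∀ x, x ≤ X → U x = U' x ∧ W x = W' x := by
    intro x hx
    have := heq (-x) (by linarith)
    simp only [neg_neg] at this
    exact ⟨by linarith [this.1], by linarith [this.2]⟩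
  have hforw := T.eq_forward T' hc hH ha' hsr' (hback X le_rfl).1 (hback X le_rfl).2
  have hall : ∀ x, U x = U' x ∧ W x = W' x := fun x =>
    (le_total x X).elim (hback x) (hforw x)
  exact ⟨funext fun x => (hall x).1, funext fun x => (hall x).2⟩

end Trajectory

/-! ### The positive branch in closed form. -/

/-- The sum of the derivatives on the branch `s > 0`, as a function of the values. -/
noncomputable def branchS (a b : ℝ) : ℝ := √(2 * (√(a ^ 2 + 3 * b ^ 2) + a) / 3)

/-- The difference of the derivatives on the branch `s > 0`, as a function of the values. -/
noncomputable def branchD (a b : ℝ) : ℝ := 2 * b / branchS a b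

/-- Eliminating d from the two equations gives 3s⁴ - 4as² - 4b² = 0; the formula is its positive
root s². -/
lemma branchS_sq {a b : ℝ} (ha : 0 < a) :
    branchS a b ^ 2 = 2 * (√(a ^ 2 + 3 * b ^ 2) + a) / 3 :=
  Real.sq_sqrt (by positivity)

lemma branchS_pos {a b : ℝ} (ha : 0 < a) : 0 < branchS a b := Real.sqrt_pos.2 (by positivity)

lemma branch_eq_b {a b : ℝ} (ha : 0 < a) : 2 * b = branchS a b * branchD a b := by
  have := (branchS_pos (b := b) ha).ne'
  rw [branchD]; field_simp

lemma branch_eq_a {a b : ℝ} (ha : 0 < a) : 4 * a = 3 * branchS a b ^ 2 - branchD a b ^ 2 := by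
  have h0 := branchS_pos (b := b) ha
  have h1 := branchS_sq (b := b) ha
  have h2 := Real.sq_sqrt (show 0 ≤ a ^ 2 + 3 * b ^ 2 by positivity)
  set r := √(a ^ 2 + 3 * b ^ 2)
  have h3 := branch_eq_b (b := b) ha
  have h4 : branchS a b ^ 2 * (3 * branchS a b ^ 2 - branchD a b ^ 2 - 4 * a) = 0 := by
    have h5 : branchS a b ^ 2 * (3 * branchS a b ^ 2 - branchD a b ^ 2 - 4 * a)
      = 3 * (branchS a b ^ 2) ^ 2 - (2 * b) ^ 2 - 4 * a * branchS a b ^ 2 := by rw [h3]; ring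
    rw [h5, h1]
    linear_combination 4 / 3 * h2
  rcases mul_eq_zero.1 h4 with h | h
  · exact absurd h (by positivity)
  · linarith

/-- The first factor is positive, so `a - |b|` and `s - |d|` have the same sign. On the faces `b =
±a` the derivative of one component of `u` vanishes. -/
lemma branch_factor {a b : ℝ} (ha : 0 < a) :
    4 * (a - |b|) = (3 * branchS a b + |branchD a b|) * (branchS a b - |branchD a b|) := by
  have h1 := branch_eq_a (b := b) ha
  have h2 : 2 * |b| = branchS a b * |branchD a b| := by
    have := congrArg abs (branch_eq_b (b := b) ha)
    rwa [abs_mul, abs_mul, abs_of_pos (branchS_pos ha), abs_two] at this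
  have h3 := sq_abs (branchD a b)
  linear_combination h1 - 2 * h2 + h3

lemma abs_branchD_le {a b : ℝ} (ha : 0 < a) (hb : |b| ≤ a) : |branchD a b| ≤ branchS a b := by
  by_contra! h
  have h1 := branch_factor (b := b) ha
  have h2 := branchS_pos (b := b) ha
  have h3 : 0 < 3 * branchS a b + |branchD a b| := by positivity
  nlinarith [mul_pos h3 (sub_pos.2 h)]

lemma branchD_self {a : ℝ} (ha : 0 < a) : branchD a a = branchS a a := by
  have h1 := branch_factor (b := a) ha
  have h2 := branchS_pos (b := a) ha
  rw [abs_of_pos ha, sub_self, mul_zero, eq_comm, mul_eq_zero] at h1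
  have h4 : 0 ≤ branchD a a := by unfold branchD; positivity
  rw [abs_of_nonneg h4] at h1
  rcases h1 with h | h <;> linarith

lemma branchS_neg (a b : ℝ) : branchS a (-b) = branchS a b := by simp [branchS]

lemma branchD_neg (a b : ℝ) : branchD a (-b) = -branchD a b := by
  simp [branchD, branchS_neg, neg_div]

lemma branchS_sq_bounds {a b : ℝ} (ha : 0 < a) (hb : |b| ≤ a) :
    4 / 3 * a ≤ branchS a b ^ 2 ∧ branchS a b ^ 2 ≤ 2 * a := by
  have h1 := branch_eq_a (b := b) ha
  have h2 : branchD a b ^ 2 ≤ branchS a b ^ 2 := by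
    rw [← sq_abs]
    exact pow_le_pow_left₀ (abs_nonneg _) (abs_branchD_le ha hb) 2
  constructor <;> nlinarith [sq_nonneg (branchD a b)]

/-- The branch is Lipschitz away from the singularity. -/
lemma branch_dist_le {a b a' b' m N : ℝ} (hm : 0 < m) (ha : 0 < a) (ha' : 0 < a')
    (hs : m ≤ branchS a b) (hs' : m ≤ branchS a' b') (h1 : |a - a'| ≤ N) (h2 : |b - b'| ≤ N) :
    |branchS a b - branchS a' b'| + |branchD a b - branchD a' b'| ≤ 4 / m * N := by
  have hid := monotone_identity (branch_eq_a (b := b) ha) (branch_eq_b ha)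
    (branch_eq_a (b := b') ha') (branch_eq_b ha')
  set e := branchS a b - branchS a' b'
  set g := branchD a b - branchD a' b'
  have h3 : (a - a') * e ≤ N * |e| :=
    (le_abs_self _).trans (by rw [abs_mul]; gcongr)
  have h4 : (b - b') * g ≤ N * |g| :=
    (le_abs_self _).trans (by rw [abs_mul]; gcongr)
  have h5 : 2 * m * (3 * |e| ^ 2 + |g| ^ 2)
      ≤ (branchS a b + branchS a' b') * (3 * |e| ^ 2 + |g| ^ 2) :=
    mul_le_mul_of_nonneg_right (by linarith) (by positivity)
  rw [← sq_abs e, ← sq_abs g] at hid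
  -- Monotonicity bounds a quadratic expression in `|e| + |g|` by a linear one; dividing gives the
  -- Lipschitz bound.
  have h6 : m / 4 * (|e| + |g|) ^ 2 ≤ N * (|e| + |g|) := by
    have h7 : (|e| + |g|) ^ 2 ≤ 2 * (3 * |e| ^ 2 + |g| ^ 2) := by
      nlinarith [sq_nonneg (|e| - |g|), sq_nonneg |e|]
    have h8 := mul_le_mul_of_nonneg_left h7 hm.le
    nlinarith
  rw [div_mul_eq_mul_div, le_div_iff₀ hm]
  rcases (add_nonneg (abs_nonneg e) (abs_nonneg g)).eq_or_lt with h | h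
  · rw [← h]; linarith [(abs_nonneg _).trans h1]
  · have : m / 4 * (|e| + |g|) ≤ N := by
      refine le_of_mul_le_mul_right ?_ h
      linarith
    linarith

/-! ### The clamped vector field. -/

/-- The vector field of the branch `s > 0`, composed with a retraction on a region where it is
regular. -/
noncomputable def clampedField (ε M : ℝ) (v : ℝ × ℝ) : ℝ × ℝ :=
  (branchS (max ε (min v.1 M)) (max (-max ε (min v.1 M)) (min v.2 (max ε (min v.1 M)))),
   branchD (max ε (min v.1 M)) (max (-max ε (min v.1 M)) (min v.2 (max ε (min v.1 M)))))

section Field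

variable {ε M : ℝ}

lemma abs_clamp_le {r t : ℝ} (hr : 0 ≤ r) : |max (-r) (min t r)| ≤ r :=
  abs_le.2 ⟨le_max_left _ _, max_le (by linarith) (min_le_right _ _)⟩

lemma clampedField_of_mem {v : ℝ × ℝ} (h1 : ε ≤ v.1) (h2 : v.1 ≤ M) (h3 : |v.2| ≤ v.1) :
    clampedField ε M v = (branchS v.1 v.2, branchD v.1 v.2) := by
  have h4 := abs_le.1 h3
  simp [clampedField, min_eq_left h2, max_eq_right h1, min_eq_left h4.2, max_eq_right h4.1]

lemma clampedField_bounds (hε : 0 < ε) (hM : ε ≤ M) (v : ℝ × ℝ) :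
    √(4 / 3 * ε) ≤ (clampedField ε M v).1 ∧ (clampedField ε M v).1 ≤ √(2 * M) ∧
      |(clampedField ε M v).2| ≤ √(2 * M) := by
  have h1 : ε ≤ max ε (min v.1 M) := le_max_left _ _
  have h2 : max ε (min v.1 M) ≤ M := max_le hM (min_le_right _ _)
  have h0 : 0 < max ε (min v.1 M) := hε.trans_le h1
  have hb := abs_clamp_le (t := v.2) h0.le
  have h3 := branchS_sq_bounds h0 hb
  have h4 := abs_branchD_le h0 hb
  have h5 := branchS_pos (b := max (-max ε (min v.1 M)) (min v.2 (max ε (min v.1 M)))) h0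
  have h6 : (clampedField ε M v).1 ≤ √(2 * M) := Real.le_sqrt_of_sq_le (h3.2.trans (by linarith))
  exact ⟨Real.sqrt_le_iff.2 ⟨h5.le, le_trans (by linarith) h3.1⟩, h6, h4.trans h6⟩

lemma norm_clampedField_le (hε : 0 < ε) (hM : ε ≤ M) (v : ℝ × ℝ) :
    ‖clampedField ε M v‖ ≤ √(2 * M) := by
  obtain ⟨h1, h2, h3⟩ := clampedField_bounds hε hM v
  rw [Prod.norm_def]
  refine max_le ?_ h3
  rw [Real.norm_eq_abs, abs_of_nonneg ((Real.sqrt_nonneg _).trans h1)]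
  exact h2

lemma lipschitz_clampedField (hε : 0 < ε) (hM : ε ≤ M) :
    ∃ K, LipschitzWith K (clampedField ε M) := by
  have hm : 0 < √(4 / 3 * ε) := Real.sqrt_pos.2 (by positivity)
  refine ⟨_, LipschitzWith.of_dist_le' (K := 4 / √(4 / 3 * ε)) fun v w => ?_⟩
  have ha : ∀ v : ℝ × ℝ, 0 < max ε (min v.1 M) := fun v => hε.trans_le (le_max_left _ _)
  have h1 : |v.1 - w.1| ≤ dist v w := by
    rw [Prod.dist_eq, ← Real.dist_eq]; exact le_max_left _ _
  have h2 : |v.2 - w.2| ≤ dist v w := by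
    rw [Prod.dist_eq, ← Real.dist_eq]; exact le_max_right _ _
  have h3 : |max ε (min v.1 M) - max ε (min w.1 M)| ≤ dist v w := by
    refine (abs_max_sub_max_le_max _ _ _ _).trans (max_le (by simp) ?_)
    refine (abs_min_sub_min_le_max _ _ _ _).trans (max_le h1 (by simp))
  have h4 : |max (-max ε (min v.1 M)) (min v.2 (max ε (min v.1 M)))
      - max (-max ε (min w.1 M)) (min w.2 (max ε (min w.1 M)))| ≤ dist v w := by
    refine (abs_max_sub_max_le_max _ _ _ _).trans (max_le ?_ ?_)
    · rw [neg_sub_neg, abs_sub_comm]; exact h3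
    · exact (abs_min_sub_min_le_max _ _ _ _).trans (max_le h2 h3)
  have h5 := branch_dist_le hm (ha v) (ha w) (clampedField_bounds hε hM v).1
    (clampedField_bounds hε hM w).1 h3 h4
  rw [Prod.dist_eq, Real.dist_eq, Real.dist_eq]
  refine (max_le ?_ ?_).trans h5
  · exact le_add_of_nonneg_right (abs_nonneg _)
  · exact le_add_of_nonneg_left (abs_nonneg _)

/-- This and the next three lemmas evaluate the field on and beyond the faces of the region (for
`|b| = a`, within `ε ≤ a ≤ M`), where clamping substitutes a value from the face; `barrier` needs
the bound there. -/
lemma clampedField_fst_le_of_le (hε : 0 < ε) {v : ℝ × ℝ} (hv : v.1 ≤ ε) :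
    (clampedField ε M v).1 ≤ √(2 * ε) := by
  have h1 : max ε (min v.1 M) = ε := max_eq_left ((min_le_left _ _).trans hv)
  simp only [clampedField, h1]
  exact Real.le_sqrt_of_sq_le (branchS_sq_bounds hε (abs_clamp_le hε.le)).2

lemma le_clampedField_fst_of_le (hε : 0 < ε) (hM : ε ≤ M) {v : ℝ × ℝ} (hv : M ≤ v.1) :
    √(4 / 3 * M) ≤ (clampedField ε M v).1 := by
  have hM0 : 0 < M := hε.trans_le hM
  have h1 : max ε (min v.1 M) = M := by rw [min_eq_right hv, max_eq_right hM]
  simp only [clampedField, h1]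
  exact Real.sqrt_le_iff.2 ⟨(branchS_pos hM0).le, (branchS_sq_bounds hM0 (abs_clamp_le hM0.le)).1⟩

lemma clampedField_snd_of_le (hε : 0 < ε) {v : ℝ × ℝ} (h1 : ε ≤ v.1) (h2 : v.1 ≤ M)
    (hv : v.1 ≤ v.2) : (clampedField ε M v).2 = (clampedField ε M v).1 := by
  have h0 : 0 < v.1 := hε.trans_le h1
  have h3 : max ε (min v.1 M) = v.1 := by rw [min_eq_left h2, max_eq_right h1]
  have h4 : max (-v.1) (min v.2 v.1) = v.1 := by
    rw [min_eq_right hv, max_eq_right (by linarith)]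
  simp only [clampedField, h3, h4]
  exact branchD_self h0

lemma clampedField_snd_of_le_neg (hε : 0 < ε) {v : ℝ × ℝ} (h1 : ε ≤ v.1) (h2 : v.1 ≤ M)
    (hv : v.2 ≤ -v.1) : (clampedField ε M v).2 = -(clampedField ε M v).1 := by
  have h0 : 0 < v.1 := hε.trans_le h1
  have h3 : max ε (min v.1 M) = v.1 := by rw [min_eq_left h2, max_eq_right h1]
  have h4 : max (-v.1) (min v.2 v.1) = -v.1 := by
    rw [min_eq_left (by linarith), max_eq_left hv]
  simp only [clampedField, h3, h4]
  rw [branchD_neg, branchS_neg, branchD_self h0]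

end Field

/-! ### Barriers and limits of solutions. -/

/-- A difference that does not decrease where it is nonpositive stays nonnegative. -/
lemma barrier {m w w' : ℝ → ℝ} {α β k : ℝ} (hm : ContinuousOn m (Icc α β))
    (hmk : ∀ y z, y ≤ z → k * (z - y) ≤ m z - m y) (hw : ContinuousOn w (Icc α β))
    (hw' : ∀ x ∈ Ico α β, HasDerivWithinAt w (w' x) (Ici x) x) (h0 : w α ≤ m α)
    (hk : ∀ x ∈ Ico α β, m x ≤ w x → w' x ≤ k) : ∀ x ∈ Icc α β, w x ≤ m x := by
  intro z hz
  by_contra! hlt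
  have hsub : Icc α z ⊆ Icc α β := Icc_subset_Icc_right hz.2
  have hclosed : IsClosed {y ∈ Icc α z | w y ≤ m y} :=
    isClosed_Icc.isClosed_le (hw.mono hsub) (hm.mono hsub)
  have hcomp : IsCompact {y ∈ Icc α z | w y ≤ m y} :=
    isCompact_Icc.of_isClosed_subset hclosed (sep_subset _ _)
  -- From the last time `t` with `w ≤ m` up to `z`, `w` grows at most at rate `k` and `m` at least
  -- at rate `k`.
  obtain ⟨t, ⟨ht, htle⟩, htmax⟩ := hcomp.exists_isGreatest ⟨α, ⟨le_rfl, hz.1⟩, h0⟩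
  have htz : t < z := lt_of_le_of_ne ht.2 fun h => absurd htle (not_le.2 (h ▸ hlt))
  have hbad : ∀ x ∈ Ioc t z, m x < w x := by
    intro x hx
    by_contra! h
    exact absurd (htmax ⟨⟨ht.1.trans hx.1.le, hx.2⟩, h⟩) (not_le.2 hx.1)
  have hteq : m t ≤ w t := by
    have hsub' : Ioo t z ⊆ Icc α β :=
      Ioo_subset_Icc_self.trans ((Icc_subset_Icc_left ht.1).trans hsub)
    have := left_nhdsWithin_Ioo_neBot htz
    refine le_of_tendsto_of_tendsto ((hm t (hsub ht)).mono hsub') ((hw t (hsub ht)).mono hsub') ?_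
    filter_upwards [self_mem_nhdsWithin] with x hx using (hbad x ⟨hx.1, hx.2.le⟩).le
  have := add_mul_le_of_right_deriv_ge (f := fun x => -w x) (f' := fun x => -w' x) (c := -k) htz.le
    (hw.mono ((Icc_subset_Icc_left ht.1).trans hsub)).neg
    (fun x hx => (hw' x ⟨ht.1.trans hx.1, hx.2.trans_le hz.2⟩).neg)
    (fun x hx => neg_le_neg (hk x ⟨ht.1.trans hx.1, hx.2.trans_le hz.2⟩ (by
      rcases hx.1.eq_or_lt with h | h
      · rw [← h]; exact hteq
      · exact (hbad x ⟨h, hx.2.le⟩).le)))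
  have h2 := hmk t z htz.le
  linarith

lemma exists_solution_Icc {E : Type*} [NormedAddCommGroup E] [NormedSpace ℝ E] [CompleteSpace E]
    {F : E → E} {γ : ℝ → E} {K : NNReal} {L : ℝ} (hF : LipschitzWith K F) (hL : ∀ v, ‖F v‖ ≤ L)
    (hγ : Continuous γ) {α β : ℝ} (hαβ : α ≤ β) (z₀ : E) :
    ∃ Z : ℝ → E, Z α = z₀ ∧
      ∀ t ∈ Icc α β, HasDerivWithinAt Z (F (γ t - Z t)) (Icc α β) t := by
  have hL0 : 0 ≤ L := (norm_nonneg _).trans (hL 0)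
  -- A field bounded by `L` moves a solution by at most `L * (β - α)`; with this radius
  -- Picard-Lindelöf covers the whole interval.
  have hP : IsPicardLindelof (fun t z => F (γ t - z)) (⟨α, left_mem_Icc.2 hαβ⟩ : Icc α β) z₀
      (⟨L, hL0⟩ * ⟨β - α, sub_nonneg.2 hαβ⟩) 0 ⟨L, hL0⟩ K := by
    refine ⟨fun t _ => ?_, fun z _ => ?_, fun t _ z _ => hL _, ?_⟩
    · refine LipschitzWith.lipschitzOnWith ?_
      have h := hF.comp ((LipschitzWith.const (γ t)).sub LipschitzWith.id)
      rw [zero_add, mul_one] at h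
      exact h
    · exact (hF.continuous.comp (hγ.sub continuous_const)).continuousOn
    · simp only [sub_self, max_eq_left (sub_nonneg.2 hαβ), NNReal.coe_zero, sub_zero]
      exact (NNReal.coe_mul ⟨L, hL0⟩ ⟨β - α, sub_nonneg.2 hαβ⟩).ge
  exact hP.exists_eq_forall_mem_Icc_hasDerivWithinAt₀

/-- A pointwise limit of solutions on growing intervals is a solution on the line. -/
lemma hasDerivAt_of_tendsto_solutions {E : Type*} [NormedAddCommGroup E] [NormedSpace ℝ E]
    [CompleteSpace E] {F : E → E} {γ : ℝ → E} {L : ℝ} (hF : Continuous F)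
    (hL : ∀ v, ‖F v‖ ≤ L) (hγ : Continuous γ) {Z : ℕ → ℝ → E} {Z' : ℝ → E}
    (hZ : ∀ n : ℕ, ∀ t ∈ Icc (-n : ℝ) n,
      HasDerivWithinAt (Z n) (F (γ t - Z n t)) (Icc (-n : ℝ) n) t)
    (hlim : ∀ t, Tendsto (fun n => Z n t) atTop (𝓝 (Z' t))) (t : ℝ) :
    HasDerivAt Z' (F (γ t - Z' t)) t := by
  have hL0 : 0 ≤ L := (norm_nonneg _).trans (hL 0)
  have hev : ∀ x y : ℝ, ∀ᶠ n : ℕ in atTop, uIcc x y ⊆ Ioo (-n : ℝ) n := by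
    intro x y
    filter_upwards [eventually_gt_atTop ⌈max |x| |y|⌉₊] with n hn
    have h1 : max |x| |y| < n := (Nat.le_ceil _).trans_lt (by exact_mod_cast hn)
    have h2 := abs_lt.1 ((le_max_left _ _).trans_lt h1)
    have h3 := abs_lt.1 ((le_max_right _ _).trans_lt h1)
    intro z hz
    rw [mem_uIcc] at hz
    rcases hz with hz | hz <;> constructor <;> linarith [hz.1, hz.2]
  have hcn : ∀ n : ℕ, ContinuousOn (fun s => F (γ s - Z n s)) (Icc (-n : ℝ) n) := fun n =>
    hF.comp_continuousOn (hγ.continuousOn.sub fun s hs => (hZ n s hs).continuousWithinAt)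
  have hint : ∀ x y, ∀ᶠ n : ℕ in atTop, ∫ s in x..y, F (γ s - Z n s) = Z n y - Z n x := by
    intro x y
    filter_upwards [hev x y] with n hn
    refine intervalIntegral.integral_eq_sub_of_hasDerivAt (fun s hs => ?_) ?_
    · exact (hZ n s (Ioo_subset_Icc_self (hn hs))).hasDerivAt (Icc_mem_nhds (hn hs).1 (hn hs).2)
    · exact ((hcn n).mono (hn.trans Ioo_subset_Icc_self)).intervalIntegrable
  -- The equation passes to the limit in integral form, by dominated convergence with the constant
  -- bound `L`.
  have hlimint : ∀ x y, ∫ s in x..y, F (γ s - Z' s) = Z' y - Z' x := by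
    intro x y
    have h1 : Tendsto (fun n => ∫ s in x..y, F (γ s - Z n s)) atTop
        (𝓝 (∫ s in x..y, F (γ s - Z' s))) := by
      refine intervalIntegral.tendsto_integral_filter_of_dominated_convergence (fun _ => L) ?_ ?_
        intervalIntegrable_const ?_
      · filter_upwards [hev x y] with n hn
        exact (((hcn n).mono (hn.trans Ioo_subset_Icc_self)).mono
          uIoc_subset_uIcc).aestronglyMeasurable measurableSet_uIoc
      · exact Eventually.of_forall fun n => Eventually.of_forall fun s _ => hL _
      · exact Eventually.of_forall fun s _ =>
          (hF.tendsto _).comp (tendsto_const_nhds.sub (hlim s))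
    exact tendsto_nhds_unique (h1.congr' (hint x y)) ((hlim y).sub (hlim x))
  have hcZ : Continuous Z' := by
    refine LipschitzWith.continuous (K := ⟨L, hL0⟩) (LipschitzWith.of_dist_le_mul fun x y => ?_)
    rw [dist_eq_norm, ← hlimint y x]
    exact intervalIntegral.norm_integral_le_of_norm_le_const fun s _ => hL _
  have hc : Continuous fun s => F (γ s - Z' s) := hF.comp (hγ.sub hcZ)
  have h := (intervalIntegral.integral_hasDerivAt_right (hc.intervalIntegrable 0 t)
    (hc.stronglyMeasurableAtFilter _ _) hc.continuousAt).add_const (Z' 0)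
  refine h.congr_of_eventuallyEq (Eventually.of_forall fun s => ?_)
  show Z' s = (∫ s in (0 : ℝ)..s, F (γ s - Z' s)) + Z' 0
  rw [hlimint]; simp

/-! ### Existence of a solution in the invariant region. -/

section Existence

variable {H J : ℝ → ℝ} {ε M : ℝ}

/-- Solutions of the clamped system stay in the region where the clamping has no effect. -/
lemma clamped_invariant (hε : 0 < ε) (hε1 : ε ≤ 1) (hM : 1 ≤ M) (hHc : Continuous H)
    (hJc : Continuous J)
    (hH : ∀ y z, y ≤ z → √(2 * ε) * (z - y) ≤ H z - H y ∧ H z - H y ≤ √(4 / 3 * M) * (z - y))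
    (hJ : ∀ y z, y ≤ z → |J z - J y| ≤ H z - H y) {α β : ℝ} {Z : ℝ → ℝ × ℝ}
    (hZα : Z α = (H α - 1, J α))
    (hZ : ∀ t ∈ Icc α β,
      HasDerivWithinAt Z (clampedField ε M ((H t, J t) - Z t)) (Icc α β) t) :
    ∀ t ∈ Icc α β, ε ≤ H t - (Z t).1 ∧ H t - (Z t).1 ≤ M ∧
      |J t - (Z t).2| ≤ H t - (Z t).1 := by
  have hεM := hε1.trans hM
  have hZr : ∀ t ∈ Ico α β,
      HasDerivWithinAt Z (clampedField ε M ((H t, J t) - Z t)) (Ici t) t := fun t ht =>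
    (hZ t ⟨ht.1, ht.2.le⟩).mono_of_mem_nhdsWithin (Icc_mem_nhdsGE_of_mem ht)
  have hd1 : ∀ t ∈ Ico α β, HasDerivWithinAt (fun t => (Z t).1)
      (clampedField ε M ((H t, J t) - Z t)).1 (Ici t) t := fun t ht => (hZr t ht).fst
  have hd2 : ∀ t ∈ Ico α β, HasDerivWithinAt (fun t => (Z t).2)
      (clampedField ε M ((H t, J t) - Z t)).2 (Ici t) t := fun t ht => (hZr t ht).snd
  have hcZ : ContinuousOn Z (Icc α β) := fun t ht => (hZ t ht).continuousWithinAt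
  have hc1 : ContinuousOn (fun t => (Z t).1) (Icc α β) := continuous_fst.comp_continuousOn hcZ
  have hc2 : ContinuousOn (fun t => (Z t).2) (Icc α β) := continuous_snd.comp_continuousOn hcZ
  -- The four faces: at `a ≤ ε` the field has `s ≤ √(2 * ε)`, at most the slope of `H`; at `a ≥ M`
  -- it has `s ≥ √(4 / 3 * M)`, at least that slope; beyond `b = a` and `b = -a` it has `d = s` and
  -- `d = -s`, while `H - J` and `H + J` are nondecreasing.
  have hlow : ∀ t ∈ Icc α β, (Z t).1 ≤ H t - ε := by
    refine barrier (k := √(2 * ε)) (by fun_prop) (fun y z h => ?_) hc1 hd1 ?_ fun t _ h => ?_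
    · linarith [(hH y z h).1]
    · rw [hZα]; linarith
    · exact clampedField_fst_le_of_le hε (by simp; linarith)
  have hhigh : ∀ t ∈ Icc α β, -(Z t).1 ≤ M - H t := by
    refine barrier (k := -√(4 / 3 * M)) (by fun_prop) (fun y z h => ?_) hc1.neg
      (fun t ht => (hd1 t ht).neg) ?_ fun t _ h => ?_
    · linarith [(hH y z h).2]
    · rw [hZα]; linarith
    · exact neg_le_neg (le_clampedField_fst_of_le hε hεM (by simp; linarith))
  have hup : ∀ t ∈ Icc α β, (Z t).1 - (Z t).2 ≤ H t - J t := by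
    refine barrier (k := 0) (by fun_prop) (fun y z h => ?_) (hc1.sub hc2)
      (fun t ht => (hd1 t ht).sub (hd2 t ht)) ?_ fun t ht h => ?_
    · linarith [(abs_le.1 (hJ y z h)).2]
    · rw [hZα]; linarith
    · have ht' := Ico_subset_Icc_self ht
      have := clampedField_snd_of_le (M := M) (v := (H t, J t) - Z t) hε
        (by simp; linarith [hlow t ht']) (by simp; linarith [hhigh t ht']) (by simp; linarith)
      linarith
  have hdown : ∀ t ∈ Icc α β, (Z t).1 + (Z t).2 ≤ H t + J t := by
    refine barrier (k := 0) (by fun_prop) (fun y z h => ?_) (hc1.add hc2)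
      (fun t ht => (hd1 t ht).add (hd2 t ht)) ?_ fun t ht h => ?_
    · linarith [(abs_le.1 (hJ y z h)).1]
    · rw [hZα]; linarith
    · have ht' := Ico_subset_Icc_self ht
      have := clampedField_snd_of_le_neg (M := M) (v := (H t, J t) - Z t) hε
        (by simp; linarith [hlow t ht']) (by simp; linarith [hhigh t ht']) (by simp; linarith)
      linarith
  intro t ht
  have h1 := hlow t ht
  have h2 := hhigh t ht
  have h3 := hup t ht
  have h4 := hdown t ht
  exact ⟨by linarith, by linarith, abs_le.2 ⟨by linarith, by linarith⟩⟩

/-- The squared distance of two branch values is controlled by the dissipation. -/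
lemma value_sq_dist_le {a b s d a' b' s' d' L : ℝ} (ha : 4 * a = 3 * s ^ 2 - d ^ 2)
    (hb : 2 * b = s * d) (ha' : 4 * a' = 3 * s' ^ 2 - d' ^ 2) (hb' : 2 * b' = s' * d')
    (hs : |s| ≤ L) (hd : |d| ≤ L) (hs' : |s'| ≤ L) (hd' : |d'| ≤ L) :
    (a - a') ^ 2 + (b - b') ^ 2 ≤ 5 * L ^ 2 * (3 * (s - s') ^ 2 + (d - d') ^ 2) := by
  have e1 : 4 * (a - a') = 3 * (s + s') * (s - s') - (d + d') * (d - d') := by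
    linear_combination ha - ha'
  have e2 : 4 * (b - b') = (s + s') * (d - d') + (d + d') * (s - s') := by
    linear_combination 2 * hb - 2 * hb'
  have hL : 0 ≤ L := (abs_nonneg s).trans hs
  have hS : (s + s') ^ 2 ≤ 4 * L ^ 2 := by
    have : |s + s'| ≤ 2 * L := (abs_add_le _ _).trans (by linarith)
    have := pow_le_pow_left₀ (abs_nonneg _) this 2
    rw [sq_abs] at this; linarith
  have hD : (d + d') ^ 2 ≤ 4 * L ^ 2 := by
    have : |d + d'| ≤ 2 * L := (abs_add_le _ _).trans (by linarith)
    have := pow_le_pow_left₀ (abs_nonneg _) this 2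
    rw [sq_abs] at this; linarith
  set S := s + s'
  set D := d + d'
  set e := s - s'
  set g := d - d'
  have h1 : 16 * (a - a') ^ 2 ≤ 2 * (9 * S ^ 2 * e ^ 2 + D ^ 2 * g ^ 2) := by
    have : 16 * (a - a') ^ 2 = (3 * S * e - D * g) ^ 2 := by rw [← e1]; ring
    rw [this]
    nlinarith [sq_nonneg (3 * S * e + D * g)]
  have h2 : 16 * (b - b') ^ 2 ≤ 2 * (S ^ 2 * g ^ 2 + D ^ 2 * e ^ 2) := by
    have : 16 * (b - b') ^ 2 = (S * g + D * e) ^ 2 := by rw [← e2]; ring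
    rw [this]
    nlinarith [sq_nonneg (S * g - D * e)]
  have h3 := mul_le_mul_of_nonneg_right hS (sq_nonneg e)
  have h4 := mul_le_mul_of_nonneg_right hS (sq_nonneg g)
  have h5 := mul_le_mul_of_nonneg_right hD (sq_nonneg e)
  have h6 := mul_le_mul_of_nonneg_right hD (sq_nonneg g)
  have h7 : 0 ≤ L ^ 2 * e ^ 2 := by positivity
  have h8 : 0 ≤ L ^ 2 * g ^ 2 := by positivity
  nlinarith

/-- Two solutions of the clamped system approach each other exponentially. -/
lemma clamped_contraction (hε : 0 < ε) (hM : ε ≤ M) {α β : ℝ} {Z Z' : ℝ → ℝ × ℝ}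
    (hZ : ∀ t ∈ Icc α β,
      HasDerivWithinAt Z (clampedField ε M ((H t, J t) - Z t)) (Icc α β) t)
    (hZ' : ∀ t ∈ Icc α β,
      HasDerivWithinAt Z' (clampedField ε M ((H t, J t) - Z' t)) (Icc α β) t)
    (hR : ∀ t ∈ Icc α β, ε ≤ H t - (Z t).1 ∧ H t - (Z t).1 ≤ M ∧
      |J t - (Z t).2| ≤ H t - (Z t).1)
    (hR' : ∀ t ∈ Icc α β, ε ≤ H t - (Z' t).1 ∧ H t - (Z' t).1 ≤ M ∧
      |J t - (Z' t).2| ≤ H t - (Z' t).1) {t : ℝ} (ht : t ∈ Icc α β) :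
    dist (Z t) (Z' t) ^ 2
      ≤ 5 * M ^ 2 * Real.exp (-(√(4 / 3 * ε) / (5 * √(2 * M) ^ 2) * (t - α))) := by
  set m := √(4 / 3 * ε) with hm
  set L := √(2 * M) with hL
  have hM0 : 0 < M := hε.trans_le hM
  have hm0 : 0 < m := Real.sqrt_pos.2 (by positivity)
  have hL0 : 0 < L := Real.sqrt_pos.2 (by positivity)
  -- Writing `Q` for the form in `monotone_identity`, the derivative of `E` is at most `-m * Q`, and
  -- `E ≤ 5 * L ^ 2 * Q` by `value_sq_dist_le`; hence the decay rate.
  set lam := m / (5 * L ^ 2) with hlam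
  have hlam0 : 0 < lam := by positivity
  set E : ℝ → ℝ := fun t => ((Z t).1 - (Z' t).1) ^ 2 + ((Z t).2 - (Z' t).2) ^ 2 with hE
  set P : ℝ → ℝ × ℝ := fun t => clampedField ε M ((H t, J t) - Z t) with hP
  set P' : ℝ → ℝ × ℝ := fun t => clampedField ε M ((H t, J t) - Z' t) with hP'
  have hZr : ∀ t ∈ Ico α β, HasDerivWithinAt Z (P t) (Ici t) t := fun t ht =>
    (hZ t ⟨ht.1, ht.2.le⟩).mono_of_mem_nhdsWithin (Icc_mem_nhdsGE_of_mem ht)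
  have hZr' : ∀ t ∈ Ico α β, HasDerivWithinAt Z' (P' t) (Ici t) t := fun t ht =>
    (hZ' t ⟨ht.1, ht.2.le⟩).mono_of_mem_nhdsWithin (Icc_mem_nhdsGE_of_mem ht)
  have hcZ : ContinuousOn Z (Icc α β) := fun t ht => (hZ t ht).continuousWithinAt
  have hcZ' : ContinuousOn Z' (Icc α β) := fun t ht => (hZ' t ht).continuousWithinAt
  have hEP : ∀ t ∈ Icc α β,
      2 * (((Z t).1 - (Z' t).1) * ((P t).1 - (P' t).1)
        + ((Z t).2 - (Z' t).2) * ((P t).2 - (P' t).2)) ≤ -lam * E t := by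
    intro t ht
    obtain ⟨r1, r2, r3⟩ := hR t ht
    obtain ⟨r1', r2', r3'⟩ := hR' t ht
    have e : P t = _ := clampedField_of_mem (v := (H t, J t) - Z t) r1 r2 r3
    have e' : P' t = _ := clampedField_of_mem (v := (H t, J t) - Z' t) r1' r2' r3'
    obtain ⟨b1, b2, b3⟩ := clampedField_bounds hε hM ((H t, J t) - Z t)
    obtain ⟨b1', b2', b3'⟩ := clampedField_bounds hε hM ((H t, J t) - Z' t)
    have p1 : 4 * (H t - (Z t).1) = 3 * (P t).1 ^ 2 - (P t).2 ^ 2 := by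
      rw [e]; exact branch_eq_a (hε.trans_le r1)
    have p2 : 2 * (J t - (Z t).2) = (P t).1 * (P t).2 := by
      rw [e]; exact branch_eq_b (hε.trans_le r1)
    have p1' : 4 * (H t - (Z' t).1) = 3 * (P' t).1 ^ 2 - (P' t).2 ^ 2 := by
      rw [e']; exact branch_eq_a (hε.trans_le r1')
    have p2' : 2 * (J t - (Z' t).2) = (P' t).1 * (P' t).2 := by
      rw [e']; exact branch_eq_b (hε.trans_le r1')
    have hid := monotone_identity p1 p2 p1' p2'
    have hv := value_sq_dist_le (L := L) p1 p2 p1' p2'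
      (abs_le.2 ⟨by linarith, b2⟩) b3 (abs_le.2 ⟨by linarith, b2'⟩) b3'
    set Q := 3 * ((P t).1 - (P' t).1) ^ 2 + ((P t).2 - (P' t).2) ^ 2 with hQ
    have hQ0 : 0 ≤ Q := by positivity
    have h1 : 2 * m * Q ≤ ((P t).1 + (P' t).1) * Q :=
      mul_le_mul_of_nonneg_right (by linarith) hQ0
    have h2 : lam * E t ≤ m * Q := by
      have h3 : E t ≤ 5 * L ^ 2 * Q := by
        refine le_trans (le_of_eq ?_) hv
        simp only [hE]; ring
      calc lam * E t ≤ lam * (5 * L ^ 2 * Q) := mul_le_mul_of_nonneg_left h3 hlam0.le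
        _ = m * Q := by rw [hlam]; field_simp
    linarith
  have hexp : ∀ t, HasDerivAt (fun t => Real.exp (lam * (t - α)))
      (Real.exp (lam * (t - α)) * lam) t := by
    intro t
    have : HasDerivAt (fun t => lam * (t - α)) (lam * 1) t :=
      ((hasDerivAt_id t).sub_const α).const_mul lam
    simpa using this.exp
  have hdE : ∀ t ∈ Ico α β, HasDerivWithinAt (fun t => -(E t * Real.exp (lam * (t - α))))
      (-(2 * (((Z t).1 - (Z' t).1) * ((P t).1 - (P' t).1)
        + ((Z t).2 - (Z' t).2) * ((P t).2 - (P' t).2)) * Real.exp (lam * (t - α))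
        + E t * (Real.exp (lam * (t - α)) * lam))) (Ici t) t := by
    intro t ht
    refine (HasDerivWithinAt.mul ?_ (hexp t).hasDerivWithinAt).neg
    have h1 : HasDerivWithinAt (fun t => (Z t).1) (P t).1 (Ici t) t := (hZr t ht).fst
    have h2 : HasDerivWithinAt (fun t => (Z t).2) (P t).2 (Ici t) t := (hZr t ht).snd
    have h1' : HasDerivWithinAt (fun t => (Z' t).1) (P' t).1 (Ici t) t := (hZr' t ht).fst
    have h2' : HasDerivWithinAt (fun t => (Z' t).2) (P' t).2 (Ici t) t := (hZr' t ht).snd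
    convert! ((h1.sub h1').pow 2).add ((h2.sub h2').pow 2) using 1
    simp only [Pi.sub_apply]
    norm_num
    ring
  have hcE : ContinuousOn (fun t => -(E t * Real.exp (lam * (t - α)))) (Icc α β) := by
    fun_prop
  have hmono := add_mul_le_of_right_deriv_ge (c := 0) ht.1
    (hcE.mono (Icc_subset_Icc_right ht.2))
    (fun x hx => hdE x ⟨hx.1, hx.2.trans_le ht.2⟩) (fun x hx => by
      have h1 := hEP x ⟨hx.1, (hx.2.trans_le ht.2).le⟩
      have h2 := Real.exp_pos (lam * (x - α))
      have h3 := mul_le_mul_of_nonneg_right h1 h2.le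
      linarith)
  simp only [sub_self, mul_zero, Real.exp_zero, mul_one, zero_mul, add_zero] at hmono
  have hEα : E α ≤ 5 * M ^ 2 := by
    have hα : α ∈ Icc α β := ⟨le_rfl, ht.1.trans ht.2⟩
    obtain ⟨r1, r2, r3⟩ := hR α hα
    obtain ⟨r1', r2', r3'⟩ := hR' α hα
    have h3 := abs_le.1 r3
    have h3' := abs_le.1 r3'
    have h4 : ((Z α).1 - (Z' α).1) ^ 2 ≤ M ^ 2 := sq_le_sq' (by linarith) (by linarith)
    have h5 : ((Z α).2 - (Z' α).2) ^ 2 ≤ (2 * M) ^ 2 := sq_le_sq' (by linarith) (by linarith)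
    simp only [hE]
    linarith
  have hdist : dist (Z t) (Z' t) ^ 2 ≤ E t := by
    rw [Prod.dist_eq]
    rcases max_cases (dist (Z t).1 (Z' t).1) (dist (Z t).2 (Z' t).2) with h | h <;>
    · rw [h.1, Real.dist_eq, sq_abs]
      simp only [hE]
      nlinarith [sq_nonneg ((Z t).1 - (Z' t).1), sq_nonneg ((Z t).2 - (Z' t).2)]
  rw [Real.exp_neg]
  refine hdist.trans ?_
  rw [← div_eq_mul_inv, le_div_iff₀ (Real.exp_pos _)]
  linarith

/-- A solution on the line that stays in the regular region. -/
lemma exists_clamped_solution (hε : 0 < ε) (hε1 : ε ≤ 1) (hM : 1 ≤ M) (hHc : Continuous H)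
    (hJc : Continuous J)
    (hH : ∀ y z, y ≤ z → √(2 * ε) * (z - y) ≤ H z - H y ∧ H z - H y ≤ √(4 / 3 * M) * (z - y))
    (hJ : ∀ y z, y ≤ z → |J z - J y| ≤ H z - H y) :
    ∃ Z : ℝ → ℝ × ℝ, (∀ t, HasDerivAt Z (clampedField ε M ((H t, J t) - Z t)) t) ∧
      ∀ t, ε ≤ H t - (Z t).1 ∧ H t - (Z t).1 ≤ M ∧ |J t - (Z t).2| ≤ H t - (Z t).1 := by
  have hεM := hε1.trans hM
  obtain ⟨K, hK⟩ := lipschitz_clampedField hε hεM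
  -- The solution on `[-n, n]` starts from `a = 1`, `b = 0`, a point of the region as `ε ≤ 1 ≤ M`.
  choose Z hZ0 hZ using fun n : ℕ => exists_solution_Icc hK (norm_clampedField_le hε hεM)
    (hHc.prodMk hJc) (show (-n : ℝ) ≤ n by linarith [n.cast_nonneg (α := ℝ)])
    (H (-n) - 1, J (-n))
  have hinv := fun n => clamped_invariant hε hε1 hM hHc hJc hH hJ (hZ0 n) (hZ n)
  set lam := √(4 / 3 * ε) / (5 * √(2 * M) ^ 2) with hlam
  have hlam0 : 0 < lam := by
    have h1 : 0 < √(4 / 3 * ε) := Real.sqrt_pos.2 (by positivity)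
    have h2 : 0 < √(2 * M) := Real.sqrt_pos.2 (by linarith)
    positivity
  have hcauchy : ∀ t, ∃ z, Tendsto (fun n => Z n t) atTop (𝓝 z) := by
    intro t
    obtain ⟨k, hk⟩ := exists_nat_ge |t|
    have hk' := abs_le.1 hk
    -- Later solutions are compared with the `n`-th on its own interval, which contains `t` since
    -- `|t| ≤ k`; by its left end contraction has acted over length `t + n + k`.
    have hcs : CauchySeq fun n => Z (n + k) t := by
      refine cauchySeq_of_le_tendsto_0'
        (fun n : ℕ => √(5 * M ^ 2 * Real.exp (-(lam * (t - -((n + k : ℕ) : ℝ)))))) ?_ ?_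
      · intro n m hnm
        have hnm' : (n : ℝ) ≤ m := by exact_mod_cast hnm
        have hn0 : (0 : ℝ) ≤ n := n.cast_nonneg
        have hsub : Icc (-((n + k : ℕ) : ℝ)) ((n + k : ℕ) : ℝ)
            ⊆ Icc (-((m + k : ℕ) : ℝ)) ((m + k : ℕ) : ℝ) := by
          apply Icc_subset_Icc <;> push_cast <;> linarith
        exact Real.le_sqrt_of_sq_le (clamped_contraction hε hεM (hZ (n + k))
          (fun s hs => (hZ (m + k) s (hsub hs)).mono hsub) (hinv (n + k))
          (fun s hs => hinv (m + k) s (hsub hs))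
          ⟨by push_cast; linarith, by push_cast; linarith⟩)
      · rw [← Real.sqrt_zero]
        refine (Real.continuous_sqrt.tendsto _).comp ?_
        rw [← mul_zero (5 * M ^ 2)]
        refine Tendsto.const_mul _ (Real.tendsto_exp_neg_atTop_nhds_zero.comp ?_)
        refine Tendsto.const_mul_atTop hlam0 ?_
        simp only [sub_neg_eq_add]
        refine tendsto_atTop_add_const_left _ _ ?_
        exact tendsto_natCast_atTop_atTop.comp (tendsto_add_atTop_nat k)
    obtain ⟨z, hz⟩ := cauchySeq_tendsto_of_complete hcs
    exact ⟨z, (tendsto_add_atTop_iff_nat k).1 hz⟩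
  choose Z' hZ' using hcauchy
  refine ⟨Z', hasDerivAt_of_tendsto_solutions hK.continuous (norm_clampedField_le hε hεM)
    (hHc.prodMk hJc) hZ hZ', fun t => ?_⟩
  obtain ⟨k, hk⟩ := exists_nat_ge |t|
  have hk' := abs_le.1 hk
  have hev : ∀ᶠ n : ℕ in atTop, t ∈ Icc (-n : ℝ) n := by
    filter_upwards [eventually_ge_atTop k] with n hn
    have : (k : ℝ) ≤ n := by exact_mod_cast hn
    exact ⟨by linarith, by linarith⟩
  have h1 : Tendsto (fun n => H t - (Z n t).1) atTop (𝓝 (H t - (Z' t).1)) :=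
    tendsto_const_nhds.sub ((continuous_fst.tendsto _).comp (hZ' t))
  have h2 : Tendsto (fun n => |J t - (Z n t).2|) atTop (𝓝 |J t - (Z' t).2|) :=
    (tendsto_const_nhds.sub ((continuous_snd.tendsto _).comp (hZ' t))).abs
  exact ⟨ge_of_tendsto h1 (hev.mono fun n hn => (hinv n t hn).1),
    le_of_tendsto h1 (hev.mono fun n hn => (hinv n t hn).2.1),
    le_of_tendsto_of_tendsto h2 h1 (hev.mono fun n hn => (hinv n t hn).2.2)⟩

end Existence

/-! ### Slopes of piecewise smooth functions. -/

lemma exists_mem_interval {N : ℕ} {x : Fin (N + 2) → EReal} (hx : IsSubdivision x) {t : ℝ}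
    (ht : ∀ j, x j ≠ t) : ∃ j, t ∈ interval x j := by
  by_contra! hcon
  have h : ∀ j : Fin (N + 2), x j < t := by
    intro j
    induction j using Fin.induction with
    | zero => rw [hx.2.1]; exact EReal.bot_lt_coe t
    | succ j ih =>
      by_contra! h
      exact hcon j ⟨ih, lt_of_le_of_ne h (ht _).symm⟩
  have := h (Fin.last (N + 1))
  rw [hx.2.2] at this
  exact not_top_lt this

lemma isOpen_interval {N : ℕ} (x : Fin (N + 2) → EReal) (j : Fin (N + 1)) :
    IsOpen (interval x j) :=
  isOpen_Ioo.preimage continuous_coe_real_ereal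

lemma IsPiecewiseSmooth.differentiableAt {N : ℕ} {x : Fin (N + 2) → EReal} {f : ℝ → ℝ}
    (hf : IsPiecewiseSmooth x f) {j : Fin (N + 1)} {t : ℝ} (ht : t ∈ interval x j) :
    DifferentiableAt ℝ f t :=
  ((hf.2 j).differentiableOn (by simp)).differentiableAt ((isOpen_interval x j).mem_nhds ht)

/-- Bounds on the slopes of a piecewise smooth function. -/
lemma IsPiecewiseSmooth.slope_bounds {N : ℕ} {x : Fin (N + 2) → EReal} (hx : IsSubdivision x)
    {f : ℝ → ℝ} (hf : IsPiecewiseSmooth x f) {c C : ℝ}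
    (hd : ∀ j, ∀ t ∈ interval x j, c ≤ deriv f t ∧ deriv f t ≤ C) {y z : ℝ} (hyz : y ≤ z) :
    c * (z - y) ≤ f z - f y ∧ f z - f y ≤ C * (z - y) := by
  -- Differentiability may fail only on this countable set, which the fundamental theorem of
  -- calculus tolerates for a continuous function.
  set S : Set ℝ := {t | ∃ j, x j = t} with hS
  have hScount : S.Countable := by
    refine (countable_range fun j => (x j).toReal).mono ?_
    rintro t ⟨j, hj⟩
    exact ⟨j, by simp [hj]⟩
  have hmem : ∀ t, t ∉ S → ∃ j, t ∈ interval x j := fun t ht =>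
    exists_mem_interval hx fun j hj => ht ⟨j, hj⟩
  have hae : ∀ᵐ t, t ∉ S := hScount.ae_notMem volume
  have hbd : ∀ᵐ t, c ≤ deriv f t ∧ deriv f t ≤ C := by
    filter_upwards [hae] with t ht
    obtain ⟨j, hj⟩ := hmem t ht
    exact hd j t hj
  have hint : IntervalIntegrable (deriv f) volume y z := by
    refine (intervalIntegrable_const (c := max |c| |C|)).mono_fun
      (measurable_deriv f).aestronglyMeasurable (ae_restrict_of_ae ?_)
    filter_upwards [hbd] with t ht
    rw [Real.norm_eq_abs, Real.norm_eq_abs]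
    refine le_trans ?_ (le_abs_self _)
    exact abs_le_max_abs_abs ht.1 ht.2
  have hftc := integral_eq_of_hasDerivAt_off_countable_of_le f (deriv f) hyz hScount
    hf.1.continuousOn (fun t ht => by
      obtain ⟨j, hj⟩ := hmem t ht.2
      exact (hf.differentiableAt hj).hasDerivAt) hint
  rw [← hftc]
  have h1 := intervalIntegral.integral_mono_ae hyz (intervalIntegrable_const (c := c)) hint
    (hbd.mono fun t ht => ht.1)
  have h2 := intervalIntegral.integral_mono_ae hyz hint (intervalIntegrable_const (c := C))
    (hbd.mono fun t ht => ht.2)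
  simp only [intervalIntegral.integral_const, smul_eq_mul] at h1 h2
  constructor <;> linarith

lemma exists_Iic_subset_interval_zero {N : ℕ} {x : Fin (N + 2) → EReal} (hx : IsSubdivision x) :
    ∃ X : ℝ, ∀ t ≤ X, t ∈ interval x 0 := by
  have h0 : x (Fin.castSucc 0) = ⊥ := hx.2.1
  have h : x (Fin.castSucc 0) < x (Fin.succ 0) := hx.1 Fin.castSucc_lt_succ
  obtain ⟨X, hX1, hX2⟩ := EReal.lt_iff_exists_real_btwn.1 h
  refine ⟨X, fun t ht => ⟨?_, ?_⟩⟩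
  · rw [h0]; exact EReal.bot_lt_coe t
  · exact (EReal.coe_le_coe_iff.2 ht).trans_lt hX2

/-! ### Classical solutions are trajectories and admissible. -/

/-- A classical solution of the system as a trajectory. -/
lemma trajectory_of_hasDerivAt {H J U W s d : ℝ → ℝ} (hU : ∀ t, HasDerivAt U (s t) t)
    (hW : ∀ t, HasDerivAt W (d t) t) (hs : Continuous s) (hd : Continuous d)
    (ha : ∀ t, 4 * (H t - U t) = 3 * s t ^ 2 - d t ^ 2) (hb : ∀ t, 2 * (J t - W t) = s t * d t)
    (hg : ∃ K, ∀ t, |U t| + |W t| ≤ K * (1 + |t|)) : Trajectory H J U W s d s d where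
  continuous_U := continuous_iff_continuousAt.2 fun t => (hU t).continuousAt
  continuous_W := continuous_iff_continuousAt.2 fun t => (hW t).continuousAt
  deriv_U_right t := (hU t).hasDerivWithinAt
  deriv_W_right t := (hW t).hasDerivWithinAt
  deriv_U_left t := (hU t).hasDerivWithinAt
  deriv_W_left t := (hW t).hasDerivWithinAt
  eq_a_right := ha
  eq_b_right := hb
  eq_a_left := ha
  eq_b_left := hb
  right_sr _ := hs.continuousWithinAt
  right_sl _ := hs.continuousWithinAt
  left_sr _ := hs.continuousWithinAt
  left_sl _ := hs.continuousWithinAt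
  left_dl _ := hd.continuousWithinAt
  jump _ _ := rfl
  growth := hg

/-- A classical solution of the system with linear growth is admissible. -/
lemma isAdmissible_of_hasDerivAt {h u p : Fin 2 → ℝ → ℝ}
    (hu : ∀ i t, HasDerivAt (u i) (p i t) t) (hp : ∀ i, Continuous (p i))
    (hHJ : ∀ t, SatisfiesHJ h t (fun i => u i t) (fun i => p i t))
    (hg : ∃ K : ℝ, ∀ (i : Fin 2) (t : ℝ), |u i t| ≤ K * (1 + |t|)) : IsAdmissible h u where
  absolutelyContinuous i a b := by
    refine ContDiffOn.absolutelyContinuousOnInterval (ContDiff.contDiffOn ?_)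
    rw [contDiff_one_iff_deriv, funext fun t => (hu i t).deriv]
    exact ⟨fun t => (hu i t).differentiableAt, hp i⟩
  equation := Eventually.of_forall fun t => ⟨fun i => (hu i t).differentiableAt, by
    simpa only [(hu _ t).deriv] using hHJ t⟩
  growth := hg
  jumps y := by
    refine ⟨fun i => p i y, fun i => p i y, fun i => ?_, fun i => ?_, fun hne => absurd rfl hne⟩
    · rw [HasRightDerivLimit, funext fun t => (hu i t).deriv]
      exact (hp i).continuousWithinAt
    · rw [HasLeftDerivLimit, funext fun t => (hu i t).deriv]
      exact (hp i).continuousWithinAt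

end CooperativeGame

/-! ### Assembly of the theorem. -/

theorem mainTheorem2 (C : ℝ) (hC : 1 < C) :
    ∃ δ : ℝ, 0 < δ ∧
      ∀ (N : ℕ) (x : Fin (N + 2) → EReal) (h : Fin 2 → ℝ → ℝ),
        CooperativeGame.IsSubdivision x →
        (∀ i : Fin 2, CooperativeGame.IsPiecewiseSmooth x (h i)) →
        (∀ (i : Fin 2) (j : Fin (N + 1)), ∀ t ∈ CooperativeGame.interval x j,
          1 / C ≤ deriv (h i) t ∧ deriv (h i) t ≤ C) →
        (∀ i : Fin 2, ∀ ξ ∈ CooperativeGame.interval x 0, ∀ η ∈ CooperativeGame.interval x 0,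
          |deriv (h i) ξ - deriv (h i) η| ≤ δ) →
        ∃! u : Fin 2 → ℝ → ℝ, CooperativeGame.IsAdmissible h u := by
  open CooperativeGame in
  have hC0 : 0 < C := by linarith
  -- The slopes of `H` and `J` deviate by at most `2δ = (2 / C) / 1000`, and `σ ≥ 2 / C`: this is
  -- the bound `η ≤ σ / 1000`.
  refine ⟨1 / (1000 * C), by positivity, fun N x h hx hh hd hosc => ?_⟩
  have hcont : ∀ i, Continuous (h i) := fun i => (hh i).1
  have hslope : ∀ i y z, y ≤ z → 1 / C * (z - y) ≤ h i z - h i y ∧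
      h i z - h i y ≤ C * (z - y) := fun i y z hyz => (hh i).slope_bounds hx (hd i) hyz
  set H : ℝ → ℝ := fun t => h 0 t + h 1 t with hHdef
  set J : ℝ → ℝ := fun t => h 0 t - h 1 t with hJdef
  have hHc : Continuous H := (hcont 0).add (hcont 1)
  have hJc : Continuous J := (hcont 0).sub (hcont 1)
  have hHs : ∀ y z, y ≤ z → 1 / C * (z - y) ≤ H z - H y ∧ H z - H y ≤ 2 * C * (z - y) := by
    intro y z hyz
    have h0 := hslope 0 y z hyz
    have h1 := hslope 1 y z hyz
    have h2 : 0 ≤ 1 / C * (z - y) := mul_nonneg (by positivity) (sub_nonneg.2 hyz)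
    simp only [hHdef]
    constructor <;> linarith
  have hJs : ∀ y z, y ≤ z → |J z - J y| ≤ H z - H y := by
    intro y z hyz
    have h0 := hslope 0 y z hyz
    have h1 := hslope 1 y z hyz
    have h2 : 0 ≤ 1 / C * (z - y) := mul_nonneg (by positivity) (sub_nonneg.2 hyz)
    simp only [hHdef, hJdef]
    exact abs_le.2 ⟨by linarith, by linarith⟩
  -- With `ε = 1 / (2 * C ^ 2)` and `M = 3 * C ^ 2`, the speeds on the faces `a = ε` and `a = M` are
  -- compared with the slope bounds `1 / C` and `2 * C` of `H`.
  have hε : √(2 * (1 / (2 * C ^ 2))) = 1 / C := by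
    rw [show 2 * (1 / (2 * C ^ 2)) = (1 / C) ^ 2 by field_simp]
    exact Real.sqrt_sq (by positivity)
  have hM : √(4 / 3 * (3 * C ^ 2)) = 2 * C := by
    rw [show 4 / 3 * (3 * C ^ 2) = (2 * C) ^ 2 by ring]
    exact Real.sqrt_sq (by positivity)
  have hε0 : 0 < 1 / (2 * C ^ 2) := by positivity
  have hε1 : 1 / (2 * C ^ 2) ≤ 1 := by
    rw [div_le_one (by positivity)]; nlinarith
  have hM1 : 1 ≤ 3 * C ^ 2 := by nlinarith
  obtain ⟨Z, hZ, hreg⟩ := exists_clamped_solution hε0 hε1 hM1 hHc hJc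
    (by rw [hε, hM]; exact hHs) hJs
  set F := clampedField (1 / (2 * C ^ 2)) (3 * C ^ 2) with hF
  have hcF : Continuous F := (lipschitz_clampedField hε0 (hε1.trans hM1)).choose_spec.continuous
  have hcZ : Continuous Z := continuous_iff_continuousAt.2 fun t => (hZ t).continuousAt
  set P : ℝ → ℝ × ℝ := fun t => F ((H t, J t) - Z t) with hP
  have hcP : Continuous P := hcF.comp ((hHc.prodMk hJc).sub hcZ)
  have hPb : ∀ t, P t = (branchS (H t - (Z t).1) (J t - (Z t).2),
      branchD (H t - (Z t).1) (J t - (Z t).2)) := fun t =>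
    clampedField_of_mem (v := (H t, J t) - Z t) (hreg t).1 (hreg t).2.1 (hreg t).2.2
  have hapos : ∀ t, 0 < H t - (Z t).1 := fun t => hε0.trans_le (hreg t).1
  have heqa : ∀ t, 4 * (H t - (Z t).1) = 3 * (P t).1 ^ 2 - (P t).2 ^ 2 := fun t => by
    rw [hPb]; exact branch_eq_a (hapos t)
  have heqb : ∀ t, 2 * (J t - (Z t).2) = (P t).1 * (P t).2 := fun t => by
    rw [hPb]; exact branch_eq_b (hapos t)
  have hbounds := fun t => clampedField_bounds hε0 (hε1.trans hM1) ((H t, J t) - Z t)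
  have hdU : ∀ t, HasDerivAt (fun t => (Z t).1) (P t).1 t := fun t => (hZ t).fst
  have hdW : ∀ t, HasDerivAt (fun t => (Z t).2) (P t).2 t := fun t => (hZ t).snd
  have hgrow : ∃ K, ∀ t, |(Z t).1| + |(Z t).2| ≤ K * (1 + |t|) := by
    refine ⟨|H 0| + |J 0| + 4 * C + 2 * (3 * C ^ 2), fun t => ?_⟩
    have h1 := abs_le_linear_of_slopes (f := H) (C := 2 * C)
      (fun y z hyz => by
        rw [abs_of_nonneg ((abs_nonneg _).trans (hJs y z hyz))]
        exact (hHs y z hyz).2) t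
    have h2 := abs_le_linear_of_slopes (f := J) (C := 2 * C)
      (fun y z hyz => (hJs y z hyz).trans (hHs y z hyz).2) t
    have h3 := abs_sub_abs_le_abs_sub (Z t).1 (H t)
    have h4 := abs_sub_abs_le_abs_sub (Z t).2 (J t)
    rw [abs_sub_comm (Z t).1, abs_of_pos (hapos t)] at h3
    rw [abs_sub_comm (Z t).2] at h4
    have h5 := hreg t
    have h6 : 0 ≤ |H 0| * |t| := by positivity
    have h7 : 0 ≤ |J 0| * |t| := by positivity
    have h8 : 0 ≤ 2 * (3 * C ^ 2) * |t| := by positivity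
    linarith
  have T := trajectory_of_hasDerivAt hdU hdW (continuous_fst.comp hcP) (continuous_snd.comp hcP)
    heqa heqb hgrow
  obtain ⟨X, hX⟩ := exists_Iic_subset_interval_zero hx
  have hdiff : ∀ i, ∀ t ≤ X, DifferentiableAt ℝ (h i) t := fun i t ht =>
    (hh i).differentiableAt (hX t ht)
  have hdH : ∀ t ≤ X, deriv H t = deriv (h 0) t + deriv (h 1) t := fun t ht =>
    deriv_fun_add (hdiff 0 t ht) (hdiff 1 t ht)
  have hdJ : ∀ t ≤ X, deriv J t = deriv (h 0) t - deriv (h 1) t := fun t ht =>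
    deriv_fun_sub (hdiff 0 t ht) (hdiff 1 t ht)
  -- The slopes at `X` give the reference values `σ = κ 0 + κ 1` and `β = κ 0 - κ 1`; `|β| ≤ σ`
  -- because both are positive.
  set κ : Fin 2 → ℝ := fun i => deriv (h i) X with hκ
  have hκ0 : ∀ i, 1 / C ≤ κ i := fun i => (hd i 0 X (hX X le_rfl)).1
  have hCinv : 0 < 1 / C := by positivity
  have hosc' : ∀ i, ∀ t ≤ X, |deriv (h i) t - κ i| ≤ 1 / (1000 * C) := fun i t ht =>
    hosc i t (hX t ht) X (hX X le_rfl)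
  have huniq : ∀ u, IsAdmissible h u → (fun t => u 0 t + u 1 t) = (fun t => (Z t).1) ∧
      (fun t => u 0 t - u 1 t) = fun t => (Z t).2 := by
    intro u hu
    obtain ⟨sr, dr, sl, dl, T'⟩ := hu.exists_trajectory hcont
    refine T'.unique T (c := 1 / C) (C := 2 * C) (X := X) (σ := κ 0 + κ 1) (β := κ 0 - κ 1)
      (η := 2 * (1 / (1000 * C))) (m := √(4 / 3 * (1 / (2 * C ^ 2))))
      (M := √(2 * (3 * C ^ 2))) hCinv hHc hJc hHs
      (fun y z hyz => (hJs y z hyz).trans (hHs y z hyz).2)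
      (fun t ht => (hdiff 0 t ht).add (hdiff 1 t ht))
      (fun t ht => (hdiff 0 t ht).sub (hdiff 1 t ht)) ?_ ?_ ?_ ?_ ?_
      (Real.sqrt_pos.2 (by positivity)) hapos ?_ ?_ ?_ ?_
    · linarith [hκ0 0, hκ0 1]
    · exact abs_le.2 ⟨by linarith [hκ0 0, hκ0 1], by linarith [hκ0 0, hκ0 1]⟩
    · have : 2 * (1 / (1000 * C)) = 2 * (1 / C) / 1000 := by field_simp
      linarith [hκ0 0, hκ0 1]
    · intro t ht
      have h0 := abs_le.1 (hosc' 0 t ht)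
      have h1 := abs_le.1 (hosc' 1 t ht)
      rw [hdH t ht]
      exact abs_le.2 ⟨by linarith, by linarith⟩
    · intro t ht
      have h0 := abs_le.1 (hosc' 0 t ht)
      have h1 := abs_le.1 (hosc' 1 t ht)
      rw [hdJ t ht]
      exact abs_le.2 ⟨by linarith, by linarith⟩
    · exact fun t => (Real.sqrt_nonneg _).trans (hbounds t).1
    · exact fun t => (hbounds t).1
    · exact fun t => abs_le.2 ⟨by
        linarith [(Real.sqrt_nonneg _).trans (hbounds t).1, (hbounds t).2.1,
          Real.sqrt_nonneg (2 * (3 * C ^ 2))], (hbounds t).2.1⟩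
    · exact fun t => (hbounds t).2.2
  refine ⟨![fun t => ((Z t).1 + (Z t).2) / 2, fun t => ((Z t).1 - (Z t).2) / 2], ?_, ?_⟩
  · refine isAdmissible_of_hasDerivAt
      (p := ![fun t => ((P t).1 + (P t).2) / 2, fun t => ((P t).1 - (P t).2) / 2]) ?_ ?_ ?_ ?_
    · intro i t
      fin_cases i
      · exact ((hdU t).add (hdW t)).div_const 2
      · exact ((hdU t).sub (hdW t)).div_const 2
    · intro i
      fin_cases i
      · exact ((continuous_fst.comp hcP).add (continuous_snd.comp hcP)).div_const 2
      · exact ((continuous_fst.comp hcP).sub (continuous_snd.comp hcP)).div_const 2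
    · intro t
      have h1 := heqa t
      have h2 := heqb t
      simp only [hHdef, hJdef] at h1 h2
      constructor
      · simp
        linear_combination -h1 / 8 - h2 / 4
      · simp
        linear_combination -h1 / 8 + h2 / 4
    · obtain ⟨K, hK⟩ := hgrow
      refine ⟨K, fun i t => ?_⟩
      have h1 := hK t
      have h2 := abs_nonneg (Z t).1
      have h3 := abs_nonneg (Z t).2
      fin_cases i
      · show |((Z t).1 + (Z t).2) / 2| ≤ _
        rw [abs_div, abs_two]
        linarith [abs_add_le (Z t).1 (Z t).2]
      · show |((Z t).1 - (Z t).2) / 2| ≤ _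
        rw [abs_div, abs_two]
        linarith [abs_sub (Z t).1 (Z t).2]
  · intro u hu
    obtain ⟨h1, h2⟩ := huniq u hu
    funext i t
    have h1t : u 0 t + u 1 t = (Z t).1 := congrFun h1 t
    have h2t : u 0 t - u 1 t = (Z t).2 := congrFun h2 t
    fin_cases i
    · show u 0 t = ((Z t).1 + (Z t).2) / 2
      linarith
    · show u 1 t = ((Z t).1 - (Z t).2) / 2
      linarith
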